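/- **Setting.** Let $S=\{\xi^1,\dots,\xi^n\}$ ($n\ge 1$) be a finite sample set, $\Theta\subseteq\mathbb R^q$ compact and convex, and $F(\theta)=\frac1n\sum_{s=1}^n F(\theta;\xi^s)$ with $F(\theta;\xi)=\varphi(f(\theta;\xi);\xi)$. Here $f=g-h$ takes values in $\mathbb R^d$, each component of $g(\cdot;\xi)$ and of $h(\cdot;\xi)$ is a maximum of $K\ge 1$ affine functions of $\theta$, and each $\varphi(\cdot;\xi):\mathbb R^d\to\mathbb R$ is B-differentiable (locally Lipschitz and directionally differentiable). For $\varepsilon\ge 0$ let $\mathcal I^\varepsilon(\theta')$ be the finite set of pairs $I=(I_1,I_2)$ of index mappings that assign to each component and each $\xi\in S$ an index of a piece of $g$, respectively $h$, whose value at $\theta'$ is within $\varepsilon$ of the maximum. Let $\widehat F(\theta;\theta',\xi,I)$ be a surrogate family such that for all $\xi\in S$, $\theta'\in\Theta$: (a) for all $\varepsilon\ge 0$ and $I\in\mathcal I^\varepsilon(\theta')$, $\widehat F(\cdot;\theta',\xi,I)$ is convex on $\Theta$ and $\widehat F(\cdot;\theta',\xi,I)\ge F(\cdot;\xi)$ on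 $\Theta$; (b) $\widehat F(\theta';\theta',\xi,I)=F(\theta';\xi)$ for $I\in\mathcal I^0(\theta')$; (c) $\widehat F(\cdot;\cdot,\xi,I)$ is continuous on $\Theta\times\Theta$ for each fixed index mapping pair $I$; (d) for all $\varepsilon\ge 0$, $\min_{I\in\mathcal I^\varepsilon(\theta')}\widehat F(\cdot;\theta',\xi,I)$ is directionally differentiable on $\Theta$ and at $\theta'$ has the same directional derivatives as $F(\cdot;\xi)$. **Algorithm.** Given $\theta^0\in\Theta$, $T\ge 1$, $\varepsilon,\eta\ge 0$ and positive integers $N_\nu$: for $\nu=0,\dots,T-1$ draw $\xi_\nu^1,\dots,\xi_\nu^{N_\nu}$ independently and uniformly from $S$ and, independently of them, $I_\nu$ uniformly from $\mathcal I^\varepsilon(\theta^\nu)$, all given the past; let $\theta^{\nu+\frac12}$ be a minimizer over $\Theta$ of $\widehat F_{N_\nu}(\theta;\theta^\nu,I_\nu)+\frac\eta2\|\theta-\theta^\nu\|^2$, where $\widehat F_{N_\nu}$ and $F_{N_\nu}$ are the averages of $\widehat F$ and $F$ over the drawn samples; set $\theta^{\nu+1}=\theta^{\nu+\frac12}$ if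 $\widehat F_{N_\nu}(\theta^{\nu+\frac12};\theta^\nu,I_\nu)+\frac\eta2\|\theta^{\nu+\frac12}-\theta^\nu\|^2\le F_{N_\nu}(\theta^\nu)$, and $\theta^{\nu+1}=\theta^\nu$ otherwise. The output $\widetilde\theta^{\,T}$ is sampled uniformly from $\theta^0,\dots,\theta^{T-1}$, independently of these iterates. **Residual.** For $\rho>0$ let $\widehat F(\theta;\theta',I)=\frac1n\sum_s\widehat F(\theta;\theta',\xi^s,I)$, and let $P_I^\rho(\theta')$ be the minimizer over $\Theta$ of $\widehat F(\theta;\theta',I)+\frac\rho2\|\theta-\theta'\|^2$ if the minimum value is at most $F(\theta')$, and $\theta'$ otherwise. Put $\bar r^{\varepsilon,\rho}(\theta')=\frac1{|\mathcal I^\varepsilon(\theta')|}\sum_{I\in\mathcal I^\varepsilon(\theta')}\|\theta'-P_I^\rho(\theta')\|$. **Proposition 4.** (1) There is a constant $C_1>0$, depending only on the problem and the surrogate family, such that for all $\varepsilon,\eta\ge 0$, all sequences with $N_\nu\ge 2$ for every $\nu$, all $T\ge 1$, all $\theta^0\in\Theta$ and all $\rho>\eta$, every output $\widetilde\theta^{\,T}$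 of the algorithm satisfies that $\bar r^{\varepsilon,\rho}(\widetilde\theta^{\,T})$ is integrable and $$\big(\mathbb E[\bar r^{\varepsilon,\rho}(\widetilde\theta^{\,T})]\big)^2\le\frac{F(\theta^0)-\min_{\theta\in\Theta}F(\theta)+C_1\sum_{\nu=0}^{T-1}\sqrt{\log N_\nu/N_\nu}}{\frac{\rho-\eta}2\,T}.$$ If $\{N_\nu\}$ is strictly increasing with $N_0\ge 1$ (so $N_0=1$ is allowed), the same holds for all such $\varepsilon,\eta,T,\theta^0,\rho$ with a constant $C_1>0$ that may in addition depend on the sequence $\{N_\nu\}$. (2) For $\varepsilon=0$ and every $\eta>0$ there is a constant $C_2>0$, depending only on the problem, the surrogate family and $\eta$, such that for all sequences with $N_\nu\ge 1$, all $T\ge 1$, all $\theta^0\in\Theta$ and all $\rho>\eta$, $\bar r^{0,\rho}(\widetilde\theta^{\,T})$ is integrable and $$\big(\mathbb E[\bar r^{0,\rho}(\widetilde\theta^{\,T})]\big)^2\le\frac{F(\theta^0)-\min_{\theta\in\Theta}F(\theta)+C_2\sum_{\nu=0}^{T-1}1/N_\nu}{\frac{\rho-\eta}2\,T}.$$ 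-/

import Mathlib

open MeasureTheory ProbabilityTheory Filter Topology
open scoped ENNReal

universe u

/-! ### Directional derivatives and Bouligand differentiability -/

/-- `L` is the (one-sided) directional derivative `φ'(x; v)`. -/
def HasDirDeriv {V : Type*} [AddCommGroup V] [Module ℝ V]
    (φ : V → ℝ) (x v : V) (L : ℝ) : Prop :=
  Tendsto (fun τ : ℝ => (φ (x + τ • v) - φ x) / τ) (𝓝[>] 0) (𝓝 L)

/-- `φ` has a directional derivative at every point of `s` in every direction. -/
def DirDifferentiableOn {V : Type*} [AddCommGroup V] [Module ℝ V]
    (φ : V → ℝ) (s : Set V) : Prop :=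
  ∀ x ∈ s, ∀ v : V, ∃ L : ℝ, HasDirDeriv φ x v L

/-- Bouligand differentiability on the whole space. -/
def BDifferentiable {V : Type*} [NormedAddCommGroup V] [NormedSpace ℝ V] (φ : V → ℝ) : Prop :=
  LocallyLipschitz φ ∧ DirDifferentiableOn φ Set.univ

/-! ### The problem -/

/-- Data of the empirical risk minimization problem
`min_{θ ∈ Θ} F(θ) = (1/n) ∑ₛ φ(f(θ; ξˢ); ξˢ)`, where the sample set is `S = {ξ¹, …, ξⁿ}`
(a sample is represented by its index `s : Fin n`), `Θ ⊆ ℝ^q`, `f = g - h` takes values in `ℝ^d`,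
and each component of `g`, `h` is a maximum of `K` affine functions of the parameter `θ`. -/
structure ERMProblem (n d K q : ℕ) where
  /-- the pieces of `g`: sample, component, piece -/
  gPiece : Fin n → Fin d → Fin K → (EuclideanSpace ℝ (Fin q) →ᵃ[ℝ] ℝ)
  /-- the pieces of `h`: sample, component, piece -/
  hPiece : Fin n → Fin d → Fin K → (EuclideanSpace ℝ (Fin q) →ᵃ[ℝ] ℝ)
  /-- the outer function `φ(·; ξ)` -/
  φ : Fin n → EuclideanSpace ℝ (Fin d) → ℝ
  /-- the feasible set -/
  Θ : Set (EuclideanSpace ℝ (Fin q))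

/-- A pair of index mappings `(I₁, I₂)`; for every component and every sample, `I₁` picks a piece
of `g` and `I₂` picks a piece of `h`. -/
abbrev IndexMap (n d K : ℕ) : Type :=
  (Fin d → Fin n → Fin K) × (Fin d → Fin n → Fin K)

/-- A family of surrogates `F̂(θ; θ', ξ, I)`; the arguments come in this order. -/
abbrev SurrogateFamily (n d K q : ℕ) : Type :=
  EuclideanSpace ℝ (Fin q) → EuclideanSpace ℝ (Fin q) → Fin n → IndexMap n d K → ℝ

namespace ERMProblem

variable {n d K q : ℕ}

/-- `g(θ; ξ)`, componentwise. -/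
noncomputable def g (P : ERMProblem n d K q) (θ : EuclideanSpace ℝ (Fin q)) (s : Fin n)
    (ι : Fin d) : ℝ :=
  ⨆ k : Fin K, P.gPiece s ι k θ

/-- `h(θ; ξ)`, componentwise. -/
noncomputable def h (P : ERMProblem n d K q) (θ : EuclideanSpace ℝ (Fin q)) (s : Fin n)
    (ι : Fin d) : ℝ :=
  ⨆ k : Fin K, P.hPiece s ι k θ

/-- The piecewise affine decision `f(θ; ξ) = g(θ; ξ) - h(θ; ξ) ∈ ℝ^d`. -/
noncomputable def f (P : ERMProblem n d K q) (θ : EuclideanSpace ℝ (Fin q)) (s : Fin n) :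
    EuclideanSpace ℝ (Fin d) :=
  WithLp.toLp 2 fun ι => P.g θ s ι - P.h θ s ι

/-- `F(θ; ξ) = φ(f(θ; ξ); ξ)`. -/
noncomputable def Fs (P : ERMProblem n d K q) (θ : EuclideanSpace ℝ (Fin q)) (s : Fin n) : ℝ :=
  P.φ s (P.f θ s)

/-- `F(θ)`, the average of `F(θ; ξ)` over `S`. -/
noncomputable def F (P : ERMProblem n d K q) (θ : EuclideanSpace ℝ (Fin q)) : ℝ :=
  (1 / (n : ℝ)) * ∑ s : Fin n, P.Fs θ s

/-- `F_N(θ)`, the average of `F(θ; ξ)` over a drawn sample `z` of size `N`. -/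
noncomputable def FN (P : ERMProblem n d K q) {N : ℕ} (z : Fin N → Fin n)
    (θ : EuclideanSpace ℝ (Fin q)) : ℝ :=
  (1 / (N : ℝ)) * ∑ i : Fin N, P.Fs θ (z i)

open Classical in
/-- The set `I^ε(θ')` of pairs of `ε`-active index mappings at `θ'`. -/
noncomputable def activeMaps (P : ERMProblem n d K q) (ε : ℝ) (θ' : EuclideanSpace ℝ (Fin q)) :
    Finset (IndexMap n d K) :=
  Finset.univ.filter fun I =>
    (∀ (ι : Fin d) (s : Fin n), P.g θ' s ι - ε ≤ P.gPiece s ι (I.1 ι s) θ') ∧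
    (∀ (ι : Fin d) (s : Fin n), P.h θ' s ι - ε ≤ P.hPiece s ι (I.2 ι s) θ')

/-- The minimum surrogate `F̂^ε_min(θ; θ', ξ) = min_{I ∈ I^ε(θ')} F̂(θ; θ', ξ, I)`. -/
noncomputable def Fmin (P : ERMProblem n d K q) (Fhat : SurrogateFamily n d K q) (ε : ℝ)
    (θ θ' : EuclideanSpace ℝ (Fin q)) (s : Fin n) : ℝ :=
  sInf ((fun I => Fhat θ θ' s I) '' (P.activeMaps ε θ' : Set (IndexMap n d K)))

/-- The standing assumption on the surrogate family. -/
structure IsSurrogateFamily (P : ERMProblem n d K q) (Fhat : SurrogateFamily n d K q) : Prop where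
  /-- majorization, for active index mappings of every tolerance -/
  majorizes : ∀ ε : ℝ, 0 ≤ ε → ∀ θ' ∈ P.Θ, ∀ (s : Fin n), ∀ I ∈ P.activeMaps ε θ',
    ∀ θ ∈ P.Θ, P.Fs θ s ≤ Fhat θ θ' s I
  /-- convexity, for active index mappings of every tolerance -/
  convex : ∀ ε : ℝ, 0 ≤ ε → ∀ θ' ∈ P.Θ, ∀ (s : Fin n), ∀ I ∈ P.activeMaps ε θ',
    ConvexOn ℝ P.Θ fun θ => Fhat θ θ' s I
  /-- touching, for exactly active index mappings -/
  touches : ∀ θ' ∈ P.Θ, ∀ (s : Fin n), ∀ I ∈ P.activeMaps 0 θ', Fhat θ' θ' s I = P.Fs θ' s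
  /-- joint continuity for a fixed index mapping -/
  continuous : ∀ (s : Fin n) (I : IndexMap n d K),
    ContinuousOn
      (fun p : EuclideanSpace ℝ (Fin q) × EuclideanSpace ℝ (Fin q) => Fhat p.1 p.2 s I)
      (P.Θ ×ˢ P.Θ)
  /-- the minimum surrogate is directionally differentiable on `Θ` -/
  min_dirDifferentiable : ∀ ε : ℝ, 0 ≤ ε → ∀ θ' ∈ P.Θ, ∀ (s : Fin n),
    DirDifferentiableOn (fun θ => P.Fmin Fhat ε θ θ' s) P.Θ
  /-- and has the directional derivatives of `F(·; ξ)` at the reference point -/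
  min_dirDeriv : ∀ ε : ℝ, 0 ≤ ε → ∀ θ' ∈ P.Θ, ∀ (s : Fin n) (v : EuclideanSpace ℝ (Fin q)),
    ∃ L : ℝ, HasDirDeriv (fun θ => P.Fmin Fhat ε θ θ' s) θ' v L ∧
      HasDirDeriv (fun θ => P.Fs θ s) θ' v L

end ERMProblem

namespace SurrogateFamily

variable {n d K q : ℕ}

/-- `F̂(θ; θ', I)`, the average of the surrogates over `S`. -/
noncomputable def avg (Fhat : SurrogateFamily n d K q) (θ θ' : EuclideanSpace ℝ (Fin q))
    (I : IndexMap n d K) : ℝ :=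
  (1 / (n : ℝ)) * ∑ s : Fin n, Fhat θ θ' s I

/-- `F̂_N(θ; θ', I)`, the average of the surrogates over a drawn sample `z` of size `N`. -/
noncomputable def avgN (Fhat : SurrogateFamily n d K q) {N : ℕ} (z : Fin N → Fin n)
    (θ θ' : EuclideanSpace ℝ (Fin q)) (I : IndexMap n d K) : ℝ :=
  (1 / (N : ℝ)) * ∑ i : Fin N, Fhat θ θ' (z i) I

end SurrogateFamily

namespace ERMProblem

variable {n d K q : ℕ}

/-! ### The averaged residual -/

/-- The proximal objective `θ ↦ F̂(θ; θ', I) + (ρ/2) ‖θ - θ'‖²`. -/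
noncomputable def proxObj (Fhat : SurrogateFamily n d K q) (ρ : ℝ)
    (θ' : EuclideanSpace ℝ (Fin q)) (I : IndexMap n d K) (θ : EuclideanSpace ℝ (Fin q)) : ℝ :=
  SurrogateFamily.avg Fhat θ θ' I + ρ / 2 * ‖θ - θ'‖ ^ 2

/-- The proximal point, the minimizer over `Θ` of the proximal objective (it exists and is unique
for `ρ > 0` and convex surrogates that are continuous on the nonempty compact set `Θ`). -/
noncomputable def prox (P : ERMProblem n d K q) (Fhat : SurrogateFamily n d K q) (ρ : ℝ)
    (θ' : EuclideanSpace ℝ (Fin q)) (I : IndexMap n d K) : EuclideanSpace ℝ (Fin q) :=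
  Classical.epsilon fun θ => θ ∈ P.Θ ∧ IsMinOn (proxObj Fhat ρ θ' I) P.Θ θ

open Classical in
/-- The map `P^ρ_I(θ')`: the proximal point if the minimum of the proximal objective is at most
`F(θ')`, and `θ'` otherwise. -/
noncomputable def proxMap (P : ERMProblem n d K q) (Fhat : SurrogateFamily n d K q) (ρ : ℝ)
    (I : IndexMap n d K) (θ' : EuclideanSpace ℝ (Fin q)) : EuclideanSpace ℝ (Fin q) :=
  if proxObj Fhat ρ θ' I (P.prox Fhat ρ θ' I) ≤ P.F θ' then P.prox Fhat ρ θ' I else θ'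

/-- The averaged residual `r̄^{ε,ρ}(θ')`. -/
noncomputable def rbar (P : ERMProblem n d K q) (Fhat : SurrogateFamily n d K q) (ε ρ : ℝ)
    (θ' : EuclideanSpace ℝ (Fin q)) : ℝ :=
  (1 / ((P.activeMaps ε θ').card : ℝ)) *
    ∑ I ∈ P.activeMaps ε θ', ‖θ' - P.proxMap Fhat ρ I θ'‖

end ERMProblem

/-! ### The algorithm -/

open Classical in
/-- A run, on the probability space `(Ω, μ)`, of the enhanced stochastic majorization-minimization
algorithm with `T` iterations, initial point `θ₀`, parameters `ε`, `η` and sample sizes `N ν`. -/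
structure SMMRun {n d K q : ℕ} (P : ERMProblem n d K q) (Fhat : SurrogateFamily n d K q)
    (ε η : ℝ) (N : ℕ → ℕ) (T : ℕ) (θ₀ : EuclideanSpace ℝ (Fin q))
    {Ω : Type*} [MeasurableSpace Ω] (μ : Measure Ω) where
  /-- `𝓕 ν` is the information available at the beginning of iteration `ν`. -/
  𝓕 : Filtration ℕ ‹MeasurableSpace Ω›
  /-- the samples `ξ_ν^1, …, ξ_ν^{N_ν}` drawn in iteration `ν` -/
  ξ : (ν : ℕ) → Ω → (Fin (N ν) → Fin n)
  /-- the index mapping selected in iteration `ν` -/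
  I : ℕ → Ω → IndexMap n d K
  /-- the iterates -/
  θ : ℕ → Ω → EuclideanSpace ℝ (Fin q)
  /-- the candidate points `θ^{ν + 1/2}` -/
  θhalf : ℕ → Ω → EuclideanSpace ℝ (Fin q)
  /-- the iteration whose iterate is returned -/
  τ : Ω → Fin T
  measurable_θ : ∀ ν ≤ T, Measurable[𝓕 ν] (θ ν)
  measurable_ξ : ∀ ν < T, Measurable[𝓕 (ν + 1)] (ξ ν)
  measurable_I : ∀ ν < T, Measurable[𝓕 (ν + 1)] (I ν)
  measurable_τ : Measurable τ
  initial : ∀ ω, θ 0 ω = θ₀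
  /-- Given the past, the index mapping is uniform on `I^ε(θ^ν)`, the samples are independent and
  uniform on `S`, and the two draws are independent of each other. -/
  draw : ∀ ν < T, ∀ A : Set Ω, MeasurableSet[𝓕 ν] A →
    ∀ (J : IndexMap n d K) (z : Fin (N ν) → Fin n),
      μ (A ∩ {ω | I ν ω = J ∧ ξ ν ω = z}) =
        ∫⁻ ω in A,
          (if J ∈ P.activeMaps ε (θ ν ω) then ((P.activeMaps ε (θ ν ω)).card : ℝ≥0∞)⁻¹ else 0) *
            ((n : ℝ≥0∞)⁻¹) ^ N ν ∂μ
  /-- The candidate point solves the sampled proximal subproblem. -/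
  candidate : ∀ ν < T, ∀ ω, θhalf ν ω ∈ P.Θ ∧
    IsMinOn (fun θ' => SurrogateFamily.avgN Fhat (ξ ν ω) θ' (θ ν ω) (I ν ω)
      + η / 2 * ‖θ' - θ ν ω‖ ^ 2) P.Θ (θhalf ν ω)
  /-- The candidate point is accepted if it gives sufficient descent. -/
  update : ∀ ν < T, ∀ ω, θ (ν + 1) ω =
    if SurrogateFamily.avgN Fhat (ξ ν ω) (θhalf ν ω) (θ ν ω) (I ν ω)
        + η / 2 * ‖θhalf ν ω - θ ν ω‖ ^ 2 ≤ P.FN (ξ ν ω) (θ ν ω)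
    then θhalf ν ω else θ ν ω
  /-- The returned iterate is chosen uniformly … -/
  output_uniform : ∀ t : Fin T, μ {ω | τ ω = t} = (T : ℝ≥0∞)⁻¹
  /-- … and independently of the iterates. -/
  output_indep : IndepFun τ (fun ω (t : Fin T) => θ t ω) μ

/-- The output `θ̃^T` of a run. -/
def SMMRun.output {n d K q : ℕ} {P : ERMProblem n d K q} {Fhat : SurrogateFamily n d K q}
    {ε η : ℝ} {N : ℕ → ℕ} {T : ℕ} {θ₀ : EuclideanSpace ℝ (Fin q)}
    {Ω : Type*} [MeasurableSpace Ω] {μ : Measure Ω} (R : SMMRun P Fhat ε η N T θ₀ μ) (ω : Ω) :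
    EuclideanSpace ℝ (Fin q) :=
  R.θ (R.τ ω) ω

/-! Compare each iteration with the proximal step of the full objective. Fix the current point `x`
and an active index map `J`. The candidate minimizes the sampled subproblem, so its value there is
at most that of the population proximal point `p`, which does not depend on the sample. Hence the
sampled surrogate at `p` is an unbiased estimate. Averaging over samples, and using that the full
step is accepted only if its objective with weight `ρ` is at most `F x`, gives a decrease of `(ρ -
η) / 2` times the squared residual (`sampleStep_le_stepBound`, `sampleMean_stepBound_le`).

The next iterate `w` depends on the sample, so passing from the sampled objective back to `F` costs
the increment of `F - FN` between `x` and `w`. Since `S` is finite, this increment is a linear form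
in the `n` deviations of the empirical frequencies and is bounded, uniformly in the points, by
`totalDev z * (L * ‖w - x‖)`. A variance computation shows that `totalDev` has mean square at most
`n ^ 2 / N`. Bounding `‖w - x‖` by the diameter gives an error of order `1 / √N`, hence the
logarithmic rate. For `η > 0`, Young's inequality moves part of the error into the unused term `η /
2 * ‖w - x‖ ^ 2` and leaves order `1 / N`.

Telescoping (`sum_sqResidual_le`) and Jensen's inequality over the index maps, the probability space
and the output index (`rate_of_sum_sqResidual_le`) finish the argument. Measurability rests on the
continuity of the proximal point on the closed set where `J` is active; there convexity makes the
minimizer unique. -/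

/-! ### Averages over all samples of a given size -/

/-- A sum over samples of size `N + 1` splits off the first draw. -/
theorem sum_sample_succ {n N : ℕ} (f : (Fin (N + 1) → Fin n) → ℝ) :
    ∑ z, f z = ∑ k : Fin n, ∑ z : Fin N → Fin n, f (Fin.cons k z) := by
  rw [← Fintype.sum_prod_type']
  exact (Fintype.sum_equiv (Fin.consEquiv fun _ => Fin n) _ _ fun _ => rfl).symm

/-- Induction by splitting off one draw. The factor `n` on the left avoids the exponent `N - 1`. -/
theorem sum_sample_sum (n N : ℕ) (b : Fin n → ℝ) :
    (n : ℝ) * ∑ z : Fin N → Fin n, ∑ i, b (z i) = N * n ^ N * ∑ k, b k := by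
  induction N with
  | zero => simp
  | succ N ih =>
    rw [sum_sample_succ]
    simp only [Fin.sum_univ_succ, Fin.cons_zero, Fin.cons_succ, Finset.sum_add_distrib,
      Finset.sum_const, Finset.card_univ, Fintype.card_fin, Fintype.card_fun, nsmul_eq_mul,
      ← Finset.mul_sum, mul_add]
    rw [ih]
    push_cast
    ring

/-- Independence in counting form: the cross term of a new draw with the earlier ones contains the
factor `∑ k, a k`, which vanishes. -/
theorem sum_sample_sum_sq (n N : ℕ) (a : Fin n → ℝ) (ha : ∑ k, a k = 0) :
    (n : ℝ) * ∑ z : Fin N → Fin n, (∑ i, a (z i)) ^ 2 = N * n ^ N * ∑ k, a k ^ 2 := by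
  induction N with
  | zero => simp
  | succ N ih =>
    rw [sum_sample_succ]
    simp only [Fin.sum_univ_succ, Fin.cons_zero, Fin.cons_succ, add_sq, Finset.sum_add_distrib,
      Finset.sum_const, Finset.card_univ, Fintype.card_fin, Fintype.card_fun, nsmul_eq_mul,
      ← Finset.mul_sum, mul_add, ← Finset.sum_mul, ha]
    rw [ih]
    push_cast
    ring

/-- The mean of `f` over all samples of size `N`. -/
noncomputable def sampleMean {n N : ℕ} (f : (Fin N → Fin n) → ℝ) : ℝ :=
  ((n : ℝ)⁻¹) ^ N * ∑ z, f z

theorem sampleMean_mono {n N : ℕ} {f g : (Fin N → Fin n) → ℝ} (h : ∀ z, f z ≤ g z) :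
    sampleMean f ≤ sampleMean g :=
  mul_le_mul_of_nonneg_left (Finset.sum_le_sum fun z _ => h z) (by positivity)

theorem sampleMean_add {n N : ℕ} (f g : (Fin N → Fin n) → ℝ) :
    sampleMean (fun z => f z + g z) = sampleMean f + sampleMean g := by
  simp [sampleMean, Finset.sum_add_distrib, mul_add]

theorem sampleMean_sub {n N : ℕ} (f g : (Fin N → Fin n) → ℝ) :
    sampleMean (fun z => f z - g z) = sampleMean f - sampleMean g := by
  simp [sampleMean, mul_sub]

theorem sampleMean_const_mul {n N : ℕ} (c : ℝ) (f : (Fin N → Fin n) → ℝ) :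
    sampleMean (fun z => c * f z) = c * sampleMean f := by
  simp only [sampleMean, ← Finset.mul_sum]
  ring

theorem sampleMean_const {n N : ℕ} (hn : 0 < n) (c : ℝ) :
    sampleMean (fun _ : Fin N → Fin n => c) = c := by
  have : (n : ℝ) ≠ 0 := by positivity
  simp only [sampleMean, Finset.sum_const, Finset.card_univ, Fintype.card_fun, Fintype.card_fin,
    nsmul_eq_mul]
  push_cast
  rw [← mul_assoc, ← mul_pow, inv_mul_cancel₀ this, one_pow, one_mul]

theorem sampleMean_sum {n N : ℕ} {κ : Type*} (s : Finset κ) (f : κ → (Fin N → Fin n) → ℝ) :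
    sampleMean (fun z => ∑ k ∈ s, f k z) = ∑ k ∈ s, sampleMean (f k) := by
  simp only [sampleMean]
  rw [Finset.sum_comm, Finset.mul_sum]

/-- The sample average is unbiased. -/
theorem sampleMean_average {n N : ℕ} (hn : 0 < n) (hN : 0 < N) (b : Fin n → ℝ) :
    sampleMean (fun z : Fin N → Fin n => (1 / (N : ℝ)) * ∑ i, b (z i)) =
      (1 / (n : ℝ)) * ∑ k, b k := by
  have hn' : (n : ℝ) ≠ 0 := by positivity
  have hN' : (N : ℝ) ≠ 0 := by positivity
  have h := sum_sample_sum n N b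
  have h2 : ∑ z : Fin N → Fin n, ∑ i, b (z i) = (n : ℝ)⁻¹ * (N * n ^ N * ∑ k, b k) := by
    rw [← h, inv_mul_cancel_left₀ hn']
  rw [sampleMean_const_mul, sampleMean, h2, inv_pow]
  field_simp

/-- The mean square of the average of a sample from a centered population. -/
theorem sampleMean_average_sq {n N : ℕ} (hn : 0 < n) (hN : 0 < N) (a : Fin n → ℝ)
    (ha : ∑ k, a k = 0) :
    sampleMean (fun z : Fin N → Fin n => ((1 / (N : ℝ)) * ∑ i, a (z i)) ^ 2) =
      (1 / (n : ℝ)) * (∑ k, a k ^ 2) / N := by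
  have hn' : (n : ℝ) ≠ 0 := by positivity
  have hN' : (N : ℝ) ≠ 0 := by positivity
  have h := sum_sample_sum_sq n N a ha
  have h2 : ∑ z : Fin N → Fin n, (∑ i, a (z i)) ^ 2 = (n : ℝ)⁻¹ * (N * n ^ N * ∑ k, a k ^ 2) := by
    rw [← h, inv_mul_cancel_left₀ hn']
  simp only [mul_pow]
  rw [sampleMean_const_mul, sampleMean, h2, inv_pow]
  field_simp

/-- The variance is nonnegative. -/
theorem sq_sampleMean_le {n N : ℕ} (hn : 0 < n) (f : (Fin N → Fin n) → ℝ) :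
    sampleMean f ^ 2 ≤ sampleMean fun z => f z ^ 2 := by
  have h : 0 ≤ sampleMean fun z => (f z - sampleMean f) ^ 2 :=
    mul_nonneg (by positivity) (Finset.sum_nonneg fun z _ => sq_nonneg _)
  have e : (sampleMean fun z => (f z - sampleMean f) ^ 2)
      = sampleMean (fun z => (f z ^ 2 - 2 * sampleMean f * f z) + sampleMean f ^ 2) := by
    congr 1
    ext z
    ring
  rw [e, sampleMean_add, sampleMean_sub, sampleMean_const_mul, sampleMean_const hn] at h
  nlinarith

/-! ### Deviation of the empirical frequencies. -/

/-- The deviation of the empirical frequency of `s` in the sample `z` from `1 / n`. -/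
noncomputable def freqDev {n N : ℕ} (z : Fin N → Fin n) (s : Fin n) : ℝ :=
  (1 / (N : ℝ)) * ∑ i, ((1 / (n : ℝ)) - if z i = s then 1 else 0)

/-- The total deviation of the empirical frequencies of `z` from the uniform ones. -/
noncomputable def totalDev {n N : ℕ} (z : Fin N → Fin n) : ℝ :=
  ∑ s, |freqDev z s|

theorem totalDev_nonneg {n N : ℕ} (z : Fin N → Fin n) : 0 ≤ totalDev z :=
  Finset.sum_nonneg fun _ _ => abs_nonneg _

/-- The sampling error is linear in the frequency deviations, with the population values as
coefficients. All randomness sits in `freqDev`, so bounds uniform in `θ` need no covering argument.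
-/
theorem average_sub_sampleAverage {n N : ℕ} (hN : 0 < N) (z : Fin N → Fin n) (b : Fin n → ℝ) :
    (1 / (n : ℝ)) * ∑ s, b s - (1 / (N : ℝ)) * ∑ i, b (z i) = ∑ s, freqDev z s * b s := by
  have hN' : (N : ℝ) ≠ 0 := by positivity
  simp only [freqDev, mul_assoc, ← Finset.mul_sum, Finset.sum_mul, sub_mul, ite_mul, one_mul,
    zero_mul]
  rw [Finset.sum_comm]
  simp only [Finset.sum_sub_distrib, Finset.sum_ite_eq, Finset.mem_univ, if_true,
    Finset.sum_const, Finset.card_univ, Fintype.card_fin, nsmul_eq_mul, ← Finset.mul_sum]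
  field_simp

/-- A centered indicator takes values in `[-1, 1]`, so its variance is at most one. -/
theorem sampleMean_freqDev_sq_le {n N : ℕ} (hn : 0 < n) (hN : 0 < N) (s : Fin n) :
    sampleMean (fun z : Fin N → Fin n => freqDev z s ^ 2) ≤ 1 / N := by
  have hn' : (n : ℝ) ≠ 0 := by positivity
  have hn1 : (1 : ℝ) / n ≤ 1 := by
    rw [div_le_one (by positivity)]
    exact_mod_cast hn
  have hn0 : (0 : ℝ) ≤ 1 / n := by positivity
  have h0 : ∑ k : Fin n, ((1 / (n : ℝ)) - if k = s then 1 else 0) = 0 := by simp [hn']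
  refine (sampleMean_average_sq hn hN
    (fun k : Fin n => ((1 / (n : ℝ)) - if k = s then 1 else 0)) h0).trans_le ?_
  have h : ∑ k : Fin n, ((1 / (n : ℝ)) - if k = s then 1 else 0) ^ 2 ≤ ∑ _k : Fin n, (1 : ℝ) := by
    refine Finset.sum_le_sum fun k _ => ?_
    split_ifs <;> nlinarith
  rw [Finset.sum_const, Finset.card_univ, Fintype.card_fin, nsmul_eq_mul, mul_one] at h
  gcongr
  calc _ ≤ (1 / (n : ℝ)) * n := by gcongr
    _ = 1 := by field_simp

/-- Cauchy–Schwarz over the `n` frequencies costs one factor `n`; summing the `n` variances costs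
the other. -/
theorem sampleMean_totalDev_sq_le {n N : ℕ} (hn : 0 < n) (hN : 0 < N) :
    sampleMean (fun z : Fin N → Fin n => totalDev z ^ 2) ≤ n ^ 2 / N := by
  calc sampleMean (fun z : Fin N → Fin n => totalDev z ^ 2)
      ≤ sampleMean (fun z : Fin N → Fin n => n * ∑ s, freqDev z s ^ 2) := by
        refine sampleMean_mono fun z => ?_
        have := sq_sum_le_card_mul_sum_sq (s := Finset.univ) (f := fun s => |freqDev z s|)
        simpa [totalDev] using this
    _ = n * ∑ s, sampleMean (fun z : Fin N → Fin n => freqDev z s ^ 2) := by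
        rw [sampleMean_const_mul, sampleMean_sum]
    _ ≤ n * ∑ _s : Fin n, (1 / N : ℝ) := by
        gcongr with s
        exact sampleMean_freqDev_sq_le hn hN s
    _ = n ^ 2 / N := by
        simp
        ring

theorem sampleMean_totalDev_le {n N : ℕ} (hn : 0 < n) (hN : 0 < N) :
    sampleMean (fun z : Fin N → Fin n => totalDev z) ≤ n / √N := by
  refine le_of_sq_le_sq ?_ (by positivity)
  refine (sq_sampleMean_le hn _).trans ((sampleMean_totalDev_sq_le hn hN).trans_eq ?_)
  rw [div_pow, Real.sq_sqrt (by positivity)]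

/-! ### General facts on maxima, minimizers and indicators -/

theorem exists_lipschitzWith_iSup_affine {q K : ℕ} (hK : 0 < K)
    (a : Fin K → (EuclideanSpace ℝ (Fin q) →ᵃ[ℝ] ℝ)) :
    ∃ C, LipschitzWith C fun θ => ⨆ k, a k θ := by
  have : Nonempty (Fin K) := ⟨⟨0, hK⟩⟩
  choose C hC using fun k => (a k).lipschitzWith_of_finiteDimensional
  refine ⟨∑ k, C k, LipschitzWith.of_le_add_mul _ fun x y => ciSup_le fun k => ?_⟩
  have h1 : a k x ≤ a k y + C k * dist x y := (hC k).le_add_mul x y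
  have h2 : a k y ≤ ⨆ k, a k y := le_ciSup (f := fun k => a k y) (Set.finite_range _).bddAbove k
  have h3 : (C k : ℝ) * dist x y ≤ (∑ k, C k : NNReal) * dist x y := by
    gcongr
    exact Finset.single_le_sum (fun _ _ => zero_le) (Finset.mem_univ k)
  linarith

/-- Minimizers over a compact set depend continuously on a parameter where they are unique. -/
theorem continuousOn_of_unique_isMinOn {X Y : Type*} [TopologicalSpace X] [TopologicalSpace Y]
    {K : Set Y} (hK : IsCompact K) {A : Set X} {H : X → Y → ℝ}
    (hH : ContinuousOn (fun w : X × Y => H w.1 w.2) (A ×ˢ K)) {p : X → Y}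
    (hpK : ∀ x ∈ A, p x ∈ K) (hp : ∀ x ∈ A, IsMinOn (H x) K (p x))
    (hu : ∀ x ∈ A, ∀ y ∈ K, IsMinOn (H x) K y → y = p x) : ContinuousOn p A := by
  intro x hx
  -- By compactness it is enough that every cluster point of `p` at `x` equals `p x`. Passing to the
  -- limit along an ultrafilter shows that a cluster point minimizes `H x`, and uniqueness applies.
  refine hK.tendsto_nhds_of_unique_mapClusterPt
    (eventually_nhdsWithin_of_forall hpK) fun y hy hcl => hu x hx y hy ?_
  obtain ⟨U, hU, hUy⟩ := mapClusterPt_iff_ultrafilter.1 hcl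
  have hA : ∀ᶠ x' in (U : Filter X), x' ∈ A := hU self_mem_nhdsWithin
  have hUx : Tendsto id (U : Filter X) (𝓝 x) := hU.trans nhdsWithin_le_nhds
  refine isMinOn_iff.2 fun k hk => ?_
  have h1 : Tendsto (fun x' => H x' (p x')) U (𝓝 (H x y)) :=
    (hH (x, y) ⟨hx, hy⟩).tendsto.comp (tendsto_nhdsWithin_iff.2
      ⟨hUx.prodMk_nhds hUy, hA.mono fun x' hx' => ⟨hx', hpK x' hx'⟩⟩)
  have h2 : Tendsto (fun x' => H x' k) U (𝓝 (H x k)) :=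
    (hH (x, k) ⟨hx, hk⟩).tendsto.comp (tendsto_nhdsWithin_iff.2
      ⟨hUx.prodMk_nhds tendsto_const_nhds, hA.mono fun x' hx' => ⟨hx', hk⟩⟩)
  exact le_of_tendsto_of_tendsto h1 h2 (hA.mono fun x' hx' => isMinOn_iff.1 (hp x' hx') k hk)

theorem measurable_indicator_of_restrict {X : Type*} [MeasurableSpace X] {s : Set X}
    (hs : MeasurableSet s) {f : X → ℝ} (hf : Measurable fun x : s => f x) :
    Measurable (s.indicator f) := by
  refine measurable_of_restrict_of_restrict_compl hs ?_ ?_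
  · have e : s.domRestrict (s.indicator f) = fun x : s => f x := by
      ext x
      simp
    rwa [e]
  · have e : sᶜ.domRestrict (s.indicator f) = fun _ => 0 := by
      ext x
      exact Set.indicator_of_notMem x.2 f
    rw [e]
    exact measurable_const

/-- A proximal objective with convex main part has at most one minimizer. -/
theorem isMinOn_prox_unique {E : Type*} [NormedAddCommGroup E] [InnerProductSpace ℝ E]
    {Θ : Set E} {f : E → ℝ} (hf : ConvexOn ℝ Θ f) {ρ : ℝ} (hρ : 0 < ρ) (x : E) {a b : E}
    (ha : a ∈ Θ) (hb : b ∈ Θ) (hma : IsMinOn (fun θ => f θ + ρ / 2 * ‖θ - x‖ ^ 2) Θ a)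
    (hmb : IsMinOn (fun θ => f θ + ρ / 2 * ‖θ - x‖ ^ 2) Θ b) : a = b := by
  -- By convexity and the parallelogram law, the midpoint lies below the mean of the two minimal
  -- values by at least `ρ / 8 * ‖a - b‖ ^ 2`.
  have hm : (1 / 2 : ℝ) • a + (1 / 2 : ℝ) • b ∈ Θ :=
    hf.1 ha hb (by norm_num) (by norm_num) (by norm_num)
  have h1 := isMinOn_iff.1 hma _ hm
  have h2 := isMinOn_iff.1 hmb _ hm
  have h3 := hf.2 ha hb (show (0 : ℝ) ≤ 1 / 2 by norm_num) (show (0 : ℝ) ≤ 1 / 2 by norm_num)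
    (by norm_num)
  simp only [smul_eq_mul] at h1 h2 h3
  have hpl := parallelogram_law_with_norm ℝ (a - x) (b - x)
  have e1 : a - x + (b - x) = (2 : ℝ) • ((1 / 2 : ℝ) • a + (1 / 2 : ℝ) • b - x) := by
    module
  have e2 : a - x - (b - x) = a - b := by abel
  rw [e1, e2, norm_smul, Real.norm_of_nonneg (by norm_num)] at hpl
  have h4 : ρ * (‖a - b‖ * ‖a - b‖) ≤ 0 := by nlinarith
  have h5 : ‖a - b‖ * ‖a - b‖ ≤ 0 := by
    by_contra h
    exact absurd h4 (not_le.2 (mul_pos hρ (not_le.1 h)))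
  have h6 : ‖a - b‖ = 0 := mul_self_eq_zero.1 (le_antisymm h5 (mul_self_nonneg _))
  exact sub_eq_zero.1 (norm_eq_zero.1 h6)

namespace ERMProblem

variable {n d K q : ℕ} {P : ERMProblem n d K q} {Fhat : SurrogateFamily n d K q}

/-! ### Regularity of the objective -/

theorem continuous_g (hK : 0 < K) (P : ERMProblem n d K q) (s : Fin n) (ι : Fin d) :
    Continuous fun θ => P.g θ s ι :=
  (exists_lipschitzWith_iSup_affine hK (P.gPiece s ι)).choose_spec.continuous

theorem continuous_h (hK : 0 < K) (P : ERMProblem n d K q) (s : Fin n) (ι : Fin d) :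
    Continuous fun θ => P.h θ s ι :=
  (exists_lipschitzWith_iSup_affine hK (P.hPiece s ι)).choose_spec.continuous

theorem exists_lipschitzWith_f (hK : 0 < K) (P : ERMProblem n d K q) (s : Fin n) :
    ∃ C, LipschitzWith C fun θ => P.f θ s := by
  have h : ∀ ι, ∃ C, LipschitzWith C fun θ => P.g θ s ι - P.h θ s ι := fun ι => by
    obtain ⟨C, hC⟩ := exists_lipschitzWith_iSup_affine hK (P.gPiece s ι)
    obtain ⟨D, hD⟩ := exists_lipschitzWith_iSup_affine hK (P.hPiece s ι)
    exact ⟨C + D, hC.sub hD⟩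
  choose C hC using h
  have hpi : LipschitzWith (∑ ι, C ι) fun θ ι => P.g θ s ι - P.h θ s ι := by
    refine LipschitzWith.of_dist_le_mul fun x y => (dist_pi_le_iff (by positivity)).2 fun ι => ?_
    refine ((hC ι).dist_le_mul x y).trans ?_
    gcongr
    exact Finset.single_le_sum (fun _ _ => zero_le) (Finset.mem_univ ι)
  exact ⟨_, (PiLp.lipschitzWith_toLp 2 _).comp hpi⟩

theorem locallyLipschitz_Fs (hK : 0 < K) (hφ : ∀ s : Fin n, BDifferentiable (P.φ s)) (s : Fin n) :
    LocallyLipschitz fun θ => P.Fs θ s :=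
  (hφ s).1.comp (exists_lipschitzWith_f hK P s).choose_spec.locallyLipschitz

theorem continuous_Fs (hK : 0 < K) (hφ : ∀ s : Fin n, BDifferentiable (P.φ s)) (s : Fin n) :
    Continuous fun θ => P.Fs θ s :=
  (locallyLipschitz_Fs hK hφ s).continuous

theorem continuous_F (hK : 0 < K) (hφ : ∀ s : Fin n, BDifferentiable (P.φ s)) :
    Continuous P.F :=
  continuous_const.mul (continuous_finsetSum _ fun s _ => continuous_Fs hK hφ s)

theorem continuous_FN (hK : 0 < K) (hφ : ∀ s : Fin n, BDifferentiable (P.φ s)) {N : ℕ}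
    (z : Fin N → Fin n) : Continuous (P.FN z) :=
  continuous_const.mul (continuous_finsetSum _ fun i _ => continuous_Fs hK hφ (z i))

/-- Compactness of `Θ` turns the local Lipschitz property into a global one; summing the constants
serves all samples at once. -/
theorem exists_lipschitz_Fs (hK : 0 < K) (hφ : ∀ s : Fin n, BDifferentiable (P.φ s))
    (hΘ : IsCompact P.Θ) :
    ∃ L : ℝ, 0 ≤ L ∧ ∀ s, ∀ x ∈ P.Θ, ∀ y ∈ P.Θ, |P.Fs x s - P.Fs y s| ≤ L * ‖x - y‖ := by
  choose C hC using fun s => ((locallyLipschitz_Fs hK hφ s).locallyLipschitzOn (s :=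
    P.Θ)).exists_lipschitzOnWith_of_compact hΘ
  refine ⟨∑ s, C s, by positivity, fun s x hx y hy => ?_⟩
  have h := (hC s).dist_le_mul x hx y hy
  rw [Real.dist_eq, dist_eq_norm] at h
  refine h.trans ?_
  gcongr
  exact_mod_cast Finset.single_le_sum (f := C) (fun _ _ => zero_le) (Finset.mem_univ s)

/-- Stochastic errors at two points differ by at most the total deviation of the sample times a
multiple of the distance of the points. -/
theorem sampleError_sub_le {L : ℝ}
    (hL : ∀ s, ∀ x ∈ P.Θ, ∀ y ∈ P.Θ, |P.Fs x s - P.Fs y s| ≤ L * ‖x - y‖) {N : ℕ} (hN : 0 < N)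
    (z : Fin N → Fin n) {x y : EuclideanSpace ℝ (Fin q)} (hx : x ∈ P.Θ) (hy : y ∈ P.Θ) :
    (P.F y - P.FN z y) - (P.F x - P.FN z x) ≤ totalDev z * (L * ‖y - x‖) := by
  rw [F, FN, F, FN, average_sub_sampleAverage hN, average_sub_sampleAverage hN,
    ← Finset.sum_sub_distrib, totalDev, Finset.sum_mul]
  refine Finset.sum_le_sum fun s _ => ?_
  rw [← mul_sub]
  refine (le_abs_self _).trans ?_
  rw [abs_mul]
  exact mul_le_mul_of_nonneg_left (hL s y hy x hx) (abs_nonneg _)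

theorem sampleMean_FN (hn : 0 < n) {N : ℕ} (hN : 0 < N) (x : EuclideanSpace ℝ (Fin q)) :
    sampleMean (fun z : Fin N → Fin n => P.FN z x) = P.F x :=
  sampleMean_average hn hN _

/-! ### Active index mappings -/

theorem activeMaps_nonempty (hK : 0 < K) (P : ERMProblem n d K q) {ε : ℝ} (hε : 0 ≤ ε)
    (x : EuclideanSpace ℝ (Fin q)) : (P.activeMaps ε x).Nonempty := by
  have : Nonempty (Fin K) := ⟨⟨0, hK⟩⟩
  choose I₁ h₁ using fun (ι : Fin d) (s : Fin n) =>
    exists_eq_ciSup_of_finite (f := fun k => P.gPiece s ι k x)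
  choose I₂ h₂ using fun (ι : Fin d) (s : Fin n) =>
    exists_eq_ciSup_of_finite (f := fun k => P.hPiece s ι k x)
  refine ⟨(I₁, I₂), ?_⟩
  simp only [activeMaps, Finset.mem_filter, Finset.mem_univ, true_and]
  refine ⟨fun ι s => ?_, fun ι s => ?_⟩
  · rw [g, ← h₁]
    linarith
  · rw [h, ← h₂]
    linarith

/-- Activity is a finite system of weak inequalities between continuous functions. This makes the
draw probabilities measurable in the iterate. -/
theorem isClosed_setOf_mem_activeMaps (hK : 0 < K) (P : ERMProblem n d K q) (ε : ℝ)
    (J : IndexMap n d K) : IsClosed {x | J ∈ P.activeMaps ε x} := by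
  simp only [activeMaps, Finset.mem_filter, Finset.mem_univ, true_and, Set.ofPred_and,
    Set.ofPred_forall]
  refine (isClosed_iInter fun ι => isClosed_iInter fun s => ?_).inter
    (isClosed_iInter fun ι => isClosed_iInter fun s => ?_)
  · exact isClosed_le ((continuous_g hK P s ι).sub continuous_const)
      (P.gPiece s ι _).continuous_of_finiteDimensional
  · exact isClosed_le ((continuous_h hK P s ι).sub continuous_const)
      (P.hPiece s ι _).continuous_of_finiteDimensional

/-- The feasible points at which `J` is `ε`-active. -/
def activeSet (P : ERMProblem n d K q) (ε : ℝ) (J : IndexMap n d K) :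
    Set (EuclideanSpace ℝ (Fin q)) :=
  P.Θ ∩ {x | J ∈ P.activeMaps ε x}

theorem measurableSet_activeSet (hK : 0 < K) (hΘ : IsCompact P.Θ) (ε : ℝ) (J : IndexMap n d K) :
    MeasurableSet (P.activeSet ε J) :=
  (hΘ.isClosed.inter (isClosed_setOf_mem_activeMaps hK P ε J)).measurableSet

open Classical in
/-- The probability of drawing `J` at `x`. -/
noncomputable def drawWeight (P : ERMProblem n d K q) (ε : ℝ) (J : IndexMap n d K)
    (x : EuclideanSpace ℝ (Fin q)) : ℝ :=
  if J ∈ P.activeMaps ε x then ((P.activeMaps ε x).card : ℝ)⁻¹ else 0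

theorem drawWeight_nonneg (ε : ℝ) (J : IndexMap n d K) (x : EuclideanSpace ℝ (Fin q)) :
    0 ≤ P.drawWeight ε J x := by
  unfold drawWeight
  split_ifs <;> positivity

theorem drawWeight_le_one (ε : ℝ) (J : IndexMap n d K) (x : EuclideanSpace ℝ (Fin q)) :
    P.drawWeight ε J x ≤ 1 := by
  unfold drawWeight
  split_ifs with h
  · exact inv_le_one_of_one_le₀ (by exact_mod_cast Finset.card_pos.2 ⟨J, h⟩)
  · exact zero_le_one

/-- Inactive maps carry weight zero, so weighted terms need to be compared only at active ones. -/
theorem drawWeight_mul_congr {ε : ℝ} {J : IndexMap n d K} {x : EuclideanSpace ℝ (Fin q)} {a b : ℝ}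
    (h : J ∈ P.activeMaps ε x → a = b) : P.drawWeight ε J x * a = P.drawWeight ε J x * b := by
  unfold drawWeight
  split_ifs with hJ
  · rw [h hJ]
  · simp

theorem drawWeight_mul_le {ε : ℝ} {J : IndexMap n d K} {x : EuclideanSpace ℝ (Fin q)} {a b : ℝ}
    (h : J ∈ P.activeMaps ε x → a ≤ b) : P.drawWeight ε J x * a ≤ P.drawWeight ε J x * b := by
  unfold drawWeight
  split_ifs with hJ
  · exact mul_le_mul_of_nonneg_left (h hJ) (by positivity)
  · simp

theorem sum_drawWeight_mul (ε : ℝ) (x : EuclideanSpace ℝ (Fin q)) (f : IndexMap n d K → ℝ) :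
    ∑ J, P.drawWeight ε J x * f J =
      (1 / ((P.activeMaps ε x).card : ℝ)) * ∑ J ∈ P.activeMaps ε x, f J := by
  classical
  simp only [drawWeight, ite_mul, zero_mul, ← Finset.sum_filter, Finset.mul_sum, one_div]
  refine Finset.sum_congr ?_ fun _ _ => rfl
  ext J
  simp

theorem sum_drawWeight (hK : 0 < K) (P : ERMProblem n d K q) {ε : ℝ} (hε : 0 ≤ ε)
    (x : EuclideanSpace ℝ (Fin q)) : ∑ J, P.drawWeight ε J x = 1 := by
  have h := sum_drawWeight_mul (P := P) ε x fun _ => 1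
  simp only [mul_one, Finset.sum_const, nsmul_eq_mul] at h
  rw [h, one_div, inv_mul_cancel₀]
  exact_mod_cast (Finset.card_pos.2 (activeMaps_nonempty hK P hε x)).ne'

theorem measurable_drawWeight (hK : 0 < K) (P : ERMProblem n d K q) (ε : ℝ)
    (J : IndexMap n d K) : Measurable (P.drawWeight ε J) := by
  classical
  have hm : ∀ J, MeasurableSet {x | J ∈ P.activeMaps ε x} := fun J =>
    (isClosed_setOf_mem_activeMaps hK P ε J).measurableSet
  have hc : Measurable fun x => ((P.activeMaps ε x).card : ℝ) := by
    have : (fun x => ((P.activeMaps ε x).card : ℝ)) =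
        fun x => ∑ J, if J ∈ P.activeMaps ε x then (1 : ℝ) else 0 := by
      ext x
      simp
    rw [this]
    exact Finset.measurable_fun_sum _ fun J _ =>
      Measurable.ite (hm J) measurable_const measurable_const
  exact Measurable.ite (hm J) hc.inv measurable_const

end ERMProblem

namespace ERMProblem

variable {n d K q : ℕ} {P : ERMProblem n d K q} {Fhat : SurrogateFamily n d K q}

/-! ### Proximal points -/

theorem continuousOn_avg (hF : P.IsSurrogateFamily Fhat) (J : IndexMap n d K) :
    ContinuousOn (fun w : EuclideanSpace ℝ (Fin q) × EuclideanSpace ℝ (Fin q) =>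
      SurrogateFamily.avg Fhat w.1 w.2 J) (P.Θ ×ˢ P.Θ) :=
  continuousOn_const.mul (continuousOn_finsetSum _ fun s _ => hF.continuous s J)

theorem continuousOn_avgN (hF : P.IsSurrogateFamily Fhat) (J : IndexMap n d K) {N : ℕ}
    (z : Fin N → Fin n) :
    ContinuousOn (fun w : EuclideanSpace ℝ (Fin q) × EuclideanSpace ℝ (Fin q) =>
      SurrogateFamily.avgN Fhat z w.1 w.2 J) (P.Θ ×ˢ P.Θ) :=
  continuousOn_const.mul (continuousOn_finsetSum _ fun i _ => hF.continuous (z i) J)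

theorem continuousOn_proxObj (hF : P.IsSurrogateFamily Fhat) (ρ : ℝ) (J : IndexMap n d K) :
    ContinuousOn (fun w : EuclideanSpace ℝ (Fin q) × EuclideanSpace ℝ (Fin q) =>
      proxObj Fhat ρ w.2 J w.1) (P.Θ ×ˢ P.Θ) :=
  (continuousOn_avg hF J).add (by fun_prop)

theorem prox_spec (hΘ : IsCompact P.Θ) (hF : P.IsSurrogateFamily Fhat) (ρ : ℝ)
    (J : IndexMap n d K) {x : EuclideanSpace ℝ (Fin q)} (hx : x ∈ P.Θ) :
    P.prox Fhat ρ x J ∈ P.Θ ∧ IsMinOn (proxObj Fhat ρ x J) P.Θ (P.prox Fhat ρ x J) := by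
  have hc : ContinuousOn (proxObj Fhat ρ x J) P.Θ :=
    (continuousOn_proxObj hF ρ J).comp (f := fun y => (y, x)) (by fun_prop) fun y hy => ⟨hy, hx⟩
  exact Classical.epsilon_spec (hΘ.exists_isMinOn ⟨x, hx⟩ hc)

theorem convexOn_avg (hΘc : Convex ℝ P.Θ) (hF : P.IsSurrogateFamily Fhat) {ε : ℝ} (hε : 0 ≤ ε)
    {J : IndexMap n d K} {x : EuclideanSpace ℝ (Fin q)} (hx : x ∈ P.activeSet ε J) :
    ConvexOn ℝ P.Θ fun θ => SurrogateFamily.avg Fhat θ x J := by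
  classical
  have h : ∀ S : Finset (Fin n), ConvexOn ℝ P.Θ fun θ => ∑ s ∈ S, Fhat θ x s J := fun S => by
    induction S using Finset.induction_on with
    | empty => simpa using convexOn_const (0 : ℝ) hΘc
    | insert s S hs ih =>
      simp_rw [Finset.sum_insert hs]
      exact (hF.convex ε hε x hx.1 s J hx.2).add ih
  exact (h Finset.univ).smul (c := 1 / (n : ℝ)) (by positivity)

/-- `prox` is an arbitrary choice of minimizer, and convexity of the surrogate is available only for
active `J`. On `activeSet` the minimizer is unique, so the choice is forced and continuous. -/
theorem continuousOn_prox (hΘ : IsCompact P.Θ) (hΘc : Convex ℝ P.Θ)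
    (hF : P.IsSurrogateFamily Fhat) {ε ρ : ℝ} (hε : 0 ≤ ε) (hρ : 0 < ρ) (J : IndexMap n d K) :
    ContinuousOn (fun x => P.prox Fhat ρ x J) (P.activeSet ε J) := by
  refine continuousOn_of_unique_isMinOn hΘ (H := fun x y => proxObj Fhat ρ x J y) ?_
    (fun x hx => (prox_spec hΘ hF ρ J hx.1).1) (fun x hx => (prox_spec hΘ hF ρ J hx.1).2)
    fun x hx y hy hmin => ?_
  · exact (continuousOn_proxObj hF ρ J).comp (f := Prod.swap) (by fun_prop)
      fun w hw => ⟨hw.2, hw.1.1⟩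
  · exact isMinOn_prox_unique (convexOn_avg hΘc hF hε hx) hρ x hy
      (prox_spec hΘ hF ρ J hx.1).1 hmin (prox_spec hΘ hF ρ J hx.1).2

theorem proxMap_mem (hΘ : IsCompact P.Θ) (hF : P.IsSurrogateFamily Fhat) (ρ : ℝ)
    (J : IndexMap n d K) {x : EuclideanSpace ℝ (Fin q)} (hx : x ∈ P.Θ) :
    P.proxMap Fhat ρ J x ∈ P.Θ := by
  unfold proxMap
  split_ifs
  exacts [(prox_spec hΘ hF ρ J hx).1, hx]

/-! ### One step compared with the population proximal step. -/

/-- A bound on the objective at the next iterate under the sample `z`, before stochastic errors. -/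
noncomputable def stepBound (P : ERMProblem n d K q) (Fhat : SurrogateFamily n d K q) (η ρ : ℝ)
    {N : ℕ} (J : IndexMap n d K) (z : Fin N → Fin n) (x : EuclideanSpace ℝ (Fin q)) : ℝ :=
  open Classical in
  if proxObj Fhat ρ x J (P.prox Fhat ρ x J) ≤ P.F x then
    SurrogateFamily.avgN Fhat z (P.prox Fhat ρ x J) x J + η / 2 * ‖P.prox Fhat ρ x J - x‖ ^ 2
  else P.FN z x

/-- The sampled surrogate step decreases the sampled objective to `stepBound`. -/
theorem sampleStep_le_stepBound (hΘ : IsCompact P.Θ) (hF : P.IsSurrogateFamily Fhat)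
    {ε η ρ : ℝ} (hε : 0 ≤ ε) {J : IndexMap n d K} {N : ℕ} (z : Fin N → Fin n)
    {x y w : EuclideanSpace ℝ (Fin q)} (hx : x ∈ P.activeSet ε J) (hy : y ∈ P.Θ)
    (hmin : IsMinOn (fun θ' => SurrogateFamily.avgN Fhat z θ' x J + η / 2 * ‖θ' - x‖ ^ 2) P.Θ y)
    (hw : w = open Classical in
      if SurrogateFamily.avgN Fhat z y x J + η / 2 * ‖y - x‖ ^ 2 ≤ P.FN z x then y else x) :
    P.FN z w + η / 2 * ‖w - x‖ ^ 2 ≤ P.stepBound Fhat η ρ J z x := by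
  have hmaj : P.FN z y ≤ SurrogateFamily.avgN Fhat z y x J := by
    refine mul_le_mul_of_nonneg_left (Finset.sum_le_sum fun i _ => ?_) (by positivity)
    exact hF.majorizes ε hε x hx.1 (z i) J hx.2 y hy
  -- The population proximal point competes in the sampled subproblem. The sampled and the
  -- population acceptance tests are unrelated, so all four combinations occur below.
  have hu := isMinOn_iff.1 hmin _ (prox_spec hΘ hF ρ J hx.1).1
  unfold stepBound
  subst hw
  split_ifs with h1 h2 h2
  · linarith
  · linarith
  · simp only [sub_self, norm_zero]
    norm_num
    linarith
  · simp

/-- In the mean over all samples, `stepBound` decreases the objective by a multiple of the squared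
proximal residual. -/
theorem sampleMean_stepBound_le (hn : 0 < n) {N : ℕ} (hN : 0 < N) (η ρ : ℝ)
    (J : IndexMap n d K) (x : EuclideanSpace ℝ (Fin q)) :
    sampleMean (fun z : Fin N → Fin n => P.stepBound Fhat η ρ J z x) ≤
      P.F x - (ρ - η) / 2 * ‖x - P.proxMap Fhat ρ J x‖ ^ 2 := by
  -- Neither the branch nor the proximal point depends on `z`, so the sample averages are unbiased.
  -- In the accepted branch the weight `ρ / 2` of the acceptance test exceeds the weight `η / 2` of
  -- the sampled step by `(ρ - η) / 2`.
  unfold stepBound proxMap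
  split_ifs with h
  · rw [sampleMean_add, sampleMean_const hn, show sampleMean (fun z : Fin N → Fin n =>
      SurrogateFamily.avgN Fhat z (P.prox Fhat ρ x J) x J) =
      SurrogateFamily.avg Fhat (P.prox Fhat ρ x J) x J from
      sampleMean_average hn hN fun s => Fhat (P.prox Fhat ρ x J) x s J,
      norm_sub_rev x]
    unfold proxObj at h
    linarith
  · rw [sampleMean_FN hn hN]
    simp

/-- The full proximal step decreases the objective. -/
theorem F_proxMap_add_le (hΘ : IsCompact P.Θ) (hF : P.IsSurrogateFamily Fhat)
    {ε ρ : ℝ} (hε : 0 ≤ ε) {J : IndexMap n d K} {x : EuclideanSpace ℝ (Fin q)}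
    (hx : x ∈ P.activeSet ε J) :
    P.F (P.proxMap Fhat ρ J x) + ρ / 2 * ‖x - P.proxMap Fhat ρ J x‖ ^ 2 ≤ P.F x := by
  unfold proxMap
  split_ifs with h
  · rw [norm_sub_rev x]
    refine le_trans (add_le_add_left ?_ _) h
    refine mul_le_mul_of_nonneg_left (Finset.sum_le_sum fun s _ => ?_) (by positivity)
    exact hF.majorizes ε hε x hx.1 s J hx.2 _ (prox_spec hΘ hF ρ J hx.1).1
  · simp

/-! ### Measurability and boundedness on the active sets. -/

theorem continuous_prox_restrict (hΘ : IsCompact P.Θ) (hΘc : Convex ℝ P.Θ)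
    (hF : P.IsSurrogateFamily Fhat) {ε ρ : ℝ} (hε : 0 ≤ ε) (hρ : 0 < ρ) (J : IndexMap n d K) :
    Continuous fun x : P.activeSet ε J => P.prox Fhat ρ x J :=
  continuousOn_iff_continuous_domRestrict.1 (continuousOn_prox hΘ hΘc hF hε hρ J)

theorem measurableSet_accepted (hK : 0 < K) (hφ : ∀ s : Fin n, BDifferentiable (P.φ s))
    (hΘ : IsCompact P.Θ) (hΘc : Convex ℝ P.Θ)
    (hF : P.IsSurrogateFamily Fhat) {ε ρ : ℝ} (hε : 0 ≤ ε) (hρ : 0 < ρ) (J : IndexMap n d K) :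
    MeasurableSet
      {x : P.activeSet ε J | proxObj Fhat ρ x J (P.prox Fhat ρ x J) ≤ P.F x} := by
  have hp := continuous_prox_restrict hΘ hΘc hF hε hρ J
  refine measurableSet_le (Continuous.measurable ?_)
    ((continuous_F hK hφ).comp continuous_subtype_val).measurable
  exact (continuousOn_proxObj hF ρ J).comp_continuous (hp.prodMk continuous_subtype_val)
    fun x => ⟨(prox_spec hΘ hF ρ J x.2.1).1, x.2.1⟩

theorem measurable_indicator_residual (hK : 0 < K) (hφ : ∀ s : Fin n, BDifferentiable (P.φ s))
    (hΘ : IsCompact P.Θ) (hΘc : Convex ℝ P.Θ)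
    (hF : P.IsSurrogateFamily Fhat) {ε ρ : ℝ} (hε : 0 ≤ ε) (hρ : 0 < ρ) (J : IndexMap n d K) :
    Measurable ((P.activeSet ε J).indicator fun x => ‖x - P.proxMap Fhat ρ J x‖) := by
  refine measurable_indicator_of_restrict (measurableSet_activeSet hK hΘ ε J) ?_
  refine (measurable_subtype_coe.sub ?_).norm
  exact Measurable.ite (measurableSet_accepted hK hφ hΘ hΘc hF hε hρ J)
    (continuous_prox_restrict hΘ hΘc hF hε hρ J).measurable measurable_subtype_coe

theorem measurable_indicator_stepBound (hK : 0 < K) (hφ : ∀ s : Fin n, BDifferentiable (P.φ s))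
    (hΘ : IsCompact P.Θ) (hΘc : Convex ℝ P.Θ)
    (hF : P.IsSurrogateFamily Fhat) {ε ρ : ℝ} (hε : 0 ≤ ε) (η : ℝ) (hρ : 0 < ρ)
    (J : IndexMap n d K) {N : ℕ} (z : Fin N → Fin n) :
    Measurable ((P.activeSet ε J).indicator (P.stepBound Fhat η ρ J z)) := by
  have hp := continuous_prox_restrict hΘ hΘc hF hε hρ J
  refine measurable_indicator_of_restrict (measurableSet_activeSet hK hΘ ε J) ?_
  refine Measurable.ite (measurableSet_accepted hK hφ hΘ hΘc hF hε hρ J)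
    (Continuous.measurable ?_)
    ((continuous_FN hK hφ z).comp continuous_subtype_val).measurable
  refine ((continuousOn_avgN hF J z).comp_continuous (hp.prodMk continuous_subtype_val)
    fun x => ⟨(prox_spec hΘ hF ρ J x.2.1).1, x.2.1⟩).add ?_
  fun_prop

theorem exists_bound_stepBound (hK : 0 < K) (hφ : ∀ s : Fin n, BDifferentiable (P.φ s))
    (hΘ : IsCompact P.Θ) (hF : P.IsSurrogateFamily Fhat) (ε η ρ : ℝ)
    (J : IndexMap n d K) {N : ℕ} (z : Fin N → Fin n) :
    ∃ C, ∀ x, ‖(P.activeSet ε J).indicator (P.stepBound Fhat η ρ J z) x‖ ≤ C := by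
  obtain ⟨C₁, h₁⟩ := (hΘ.prod hΘ).exists_bound_of_continuousOn
    ((continuousOn_avgN hF J z).add (g := fun w => η / 2 * ‖w.1 - w.2‖ ^ 2) (by fun_prop))
  obtain ⟨C₂, h₂⟩ := hΘ.exists_bound_of_continuousOn (continuous_FN hK hφ z).continuousOn
  refine ⟨max 0 (max C₁ C₂), fun x => ?_⟩
  by_cases hx : x ∈ P.activeSet ε J
  · rw [Set.indicator_of_mem hx]
    unfold stepBound
    split_ifs
    · exact (h₁ (P.prox Fhat ρ x J, x) ⟨(prox_spec hΘ hF ρ J hx.1).1, hx.1⟩).trans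
        ((le_max_left _ _).trans (le_max_right _ _))
    · exact (h₂ x hx.1).trans ((le_max_right _ _).trans (le_max_right _ _))
  · rw [Set.indicator_of_notMem hx, norm_zero]
    exact le_max_left _ _

end ERMProblem

/-! ### Integration over finite partitions, and Jensen's inequality. -/

theorem integral_eq_sum_fiber {Ω ι : Type*} [MeasurableSpace Ω] {μ : Measure Ω} [Fintype ι]
    {Y : Ω → ι} (hY : ∀ i, MeasurableSet {ω | Y ω = i}) {g : Ω → ℝ} (hg : Integrable g μ) :
    ∫ ω, g ω ∂μ = ∑ i, ∫ ω in {ω | Y ω = i}, g ω ∂μ := by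
  rw [← integral_iUnion_fintype hY ?_ fun i => hg.integrableOn]
  · rw [show (⋃ i, {ω | Y ω = i}) = Set.univ by ext; simp, Measure.restrict_univ]
  · intro i j hij
    refine Set.disjoint_left.2 fun ω hi hj => hij ?_
    exact (Eq.symm hi).trans hj

theorem sq_integral_le {Ω : Type*} [MeasurableSpace Ω] {μ : Measure Ω} [IsProbabilityMeasure μ]
    {f : Ω → ℝ} (hf : Integrable f μ) (hf2 : Integrable (fun ω => f ω ^ 2) μ) :
    (∫ ω, f ω ∂μ) ^ 2 ≤ ∫ ω, f ω ^ 2 ∂μ :=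
  (Even.convexOn_pow even_two).map_integral_le (continuous_pow 2).continuousOn isClosed_univ
    (ae_of_all _ fun _ => Set.mem_univ _) hf hf2

namespace ERMProblem

variable {n d K q : ℕ} {P : ERMProblem n d K q} {Fhat : SurrogateFamily n d K q}

/-! ### The averaged residual and its quadratic version -/

/-- The residual for `J`, set to zero where `J` is not active. -/
noncomputable def residual (P : ERMProblem n d K q) (Fhat : SurrogateFamily n d K q) (ε ρ : ℝ)
    (J : IndexMap n d K) : EuclideanSpace ℝ (Fin q) → ℝ :=
  (P.activeSet ε J).indicator fun x => ‖x - P.proxMap Fhat ρ J x‖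

/-- The average of the squared residuals. -/
noncomputable def sqResidual (P : ERMProblem n d K q) (Fhat : SurrogateFamily n d K q) (ε ρ : ℝ)
    (x : EuclideanSpace ℝ (Fin q)) : ℝ :=
  ∑ J, P.drawWeight ε J x * P.residual Fhat ε ρ J x ^ 2

/-- The average of the residuals, in a form that is measurable on the whole space. -/
noncomputable def meanResidual (P : ERMProblem n d K q) (Fhat : SurrogateFamily n d K q) (ε ρ : ℝ)
    (x : EuclideanSpace ℝ (Fin q)) : ℝ :=
  ∑ J, P.drawWeight ε J x * P.residual Fhat ε ρ J x

theorem residual_of_active {ε ρ : ℝ} {J : IndexMap n d K} {x : EuclideanSpace ℝ (Fin q)}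
    (hx : x ∈ P.Θ) (hJ : J ∈ P.activeMaps ε x) :
    P.residual Fhat ε ρ J x = ‖x - P.proxMap Fhat ρ J x‖ :=
  Set.indicator_of_mem (show x ∈ P.activeSet ε J from ⟨hx, hJ⟩) _

/-- All iterates lie in `Θ`, so this transfers measurability and bounds to the residual of the
output. -/
theorem rbar_eq_meanResidual {ε ρ : ℝ} {x : EuclideanSpace ℝ (Fin q)} (hx : x ∈ P.Θ) :
    P.rbar Fhat ε ρ x = P.meanResidual Fhat ε ρ x := by
  rw [rbar, ← sum_drawWeight_mul, meanResidual]
  exact Finset.sum_congr rfl fun J _ => drawWeight_mul_congr fun hJ =>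
    (residual_of_active hx hJ).symm

theorem residual_nonneg (ε ρ : ℝ) (J : IndexMap n d K) (x : EuclideanSpace ℝ (Fin q)) :
    0 ≤ P.residual Fhat ε ρ J x :=
  Set.indicator_nonneg (fun _ _ => norm_nonneg _) x

theorem residual_le_diam (hΘ : IsCompact P.Θ) (hF : P.IsSurrogateFamily Fhat) (ε ρ : ℝ)
    (J : IndexMap n d K) (x : EuclideanSpace ℝ (Fin q)) :
    P.residual Fhat ε ρ J x ≤ Metric.diam P.Θ := by
  refine Set.indicator_apply_le' (fun hx => ?_) fun _ => Metric.diam_nonneg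
  rw [← dist_eq_norm]
  exact Metric.dist_le_diam_of_mem hΘ.isBounded hx.1 (proxMap_mem hΘ hF ρ J hx.1)

theorem sum_drawWeight_mul_le (hK : 0 < K) {ε : ℝ} (hε : 0 ≤ ε) {x : EuclideanSpace ℝ (Fin q)}
    {f : IndexMap n d K → ℝ} {C : ℝ} (h : ∀ J ∈ P.activeMaps ε x, f J ≤ C) :
    ∑ J, P.drawWeight ε J x * f J ≤ C := by
  calc _ ≤ ∑ J, P.drawWeight ε J x * C :=
        Finset.sum_le_sum fun J _ => drawWeight_mul_le (h J)
    _ = C := by rw [← Finset.sum_mul, sum_drawWeight hK P hε, one_mul]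

theorem sq_meanResidual_le (hK : 0 < K) {ε : ℝ} (hε : 0 ≤ ε) (ρ : ℝ)
    (x : EuclideanSpace ℝ (Fin q)) :
    P.meanResidual Fhat ε ρ x ^ 2 ≤ P.sqResidual Fhat ε ρ x :=
  (Even.convexOn_pow (𝕜 := ℝ) even_two).map_sum_le (fun J _ => drawWeight_nonneg ε J x)
    (sum_drawWeight hK P hε x) fun _ _ => Set.mem_univ _

theorem meanResidual_nonneg (ε ρ : ℝ) (x : EuclideanSpace ℝ (Fin q)) :
    0 ≤ P.meanResidual Fhat ε ρ x :=
  Finset.sum_nonneg fun J _ => mul_nonneg (drawWeight_nonneg ε J x) (residual_nonneg ε ρ J x)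

theorem sqResidual_nonneg (ε ρ : ℝ) (x : EuclideanSpace ℝ (Fin q)) :
    0 ≤ P.sqResidual Fhat ε ρ x :=
  Finset.sum_nonneg fun J _ => mul_nonneg (drawWeight_nonneg ε J x) (sq_nonneg _)

theorem meanResidual_le_diam (hK : 0 < K) (hΘ : IsCompact P.Θ) (hF : P.IsSurrogateFamily Fhat)
    {ε : ℝ} (hε : 0 ≤ ε) (ρ : ℝ) (x : EuclideanSpace ℝ (Fin q)) :
    P.meanResidual Fhat ε ρ x ≤ Metric.diam P.Θ :=
  sum_drawWeight_mul_le hK hε fun J _ => residual_le_diam hΘ hF ε ρ J x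

theorem sqResidual_le_sq_diam (hK : 0 < K) (hΘ : IsCompact P.Θ) (hF : P.IsSurrogateFamily Fhat)
    {ε : ℝ} (hε : 0 ≤ ε) (ρ : ℝ) (x : EuclideanSpace ℝ (Fin q)) :
    P.sqResidual Fhat ε ρ x ≤ Metric.diam P.Θ ^ 2 :=
  sum_drawWeight_mul_le hK hε fun J _ =>
    pow_le_pow_left₀ (residual_nonneg ε ρ J x) (residual_le_diam hΘ hF ε ρ J x) 2

theorem measurable_meanResidual (hK : 0 < K) (hφ : ∀ s : Fin n, BDifferentiable (P.φ s))
    (hΘ : IsCompact P.Θ) (hΘc : Convex ℝ P.Θ) (hF : P.IsSurrogateFamily Fhat) {ε ρ : ℝ}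
    (hε : 0 ≤ ε) (hρ : 0 < ρ) : Measurable (P.meanResidual Fhat ε ρ) :=
  Finset.measurable_fun_sum _ fun J _ => (measurable_drawWeight hK P ε J).mul
    (measurable_indicator_residual hK hφ hΘ hΘc hF hε hρ J)

theorem measurable_sqResidual (hK : 0 < K) (hφ : ∀ s : Fin n, BDifferentiable (P.φ s))
    (hΘ : IsCompact P.Θ) (hΘc : Convex ℝ P.Θ) (hF : P.IsSurrogateFamily Fhat) {ε ρ : ℝ}
    (hε : 0 ≤ ε) (hρ : 0 < ρ) : Measurable (P.sqResidual Fhat ε ρ) :=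
  Finset.measurable_fun_sum _ fun J _ => (measurable_drawWeight hK P ε J).mul
    ((measurable_indicator_residual hK hφ hΘ hΘc hF hε hρ J).pow_const 2)

theorem bddBelow_image_F (hK : 0 < K) (hφ : ∀ s : Fin n, BDifferentiable (P.φ s))
    (hΘ : IsCompact P.Θ) : BddBelow (P.F '' P.Θ) :=
  hΘ.bddBelow_image (continuous_F hK hφ).continuousOn

/-- The bound for a single point that needs no sampling. -/
theorem sqResidual_le_of_full_step (hK : 0 < K) (hφ : ∀ s : Fin n, BDifferentiable (P.φ s))
    (hΘ : IsCompact P.Θ) (hF : P.IsSurrogateFamily Fhat) {ε ρ : ℝ} (hε : 0 ≤ ε)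
    {x : EuclideanSpace ℝ (Fin q)} (hx : x ∈ P.Θ) :
    ρ / 2 * P.sqResidual Fhat ε ρ x ≤ P.F x - sInf (P.F '' P.Θ) := by
  rw [sqResidual, Finset.mul_sum]
  simp only [mul_left_comm (ρ / 2)]
  refine sum_drawWeight_mul_le hK hε fun J hJ => ?_
  rw [residual_of_active hx hJ]
  have h1 := F_proxMap_add_le (ρ := ρ) hΘ hF hε (J := J) ⟨hx, hJ⟩
  have h2 := csInf_le (bddBelow_image_F hK hφ hΘ) ⟨_, proxMap_mem hΘ hF ρ J hx, rfl⟩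
  linarith

end ERMProblem

namespace SMMRun

variable {n d K q : ℕ} {P : ERMProblem n d K q} {Fhat : SurrogateFamily n d K q}
  {ε η : ℝ} {N : ℕ → ℕ} {T : ℕ} {θ₀ : EuclideanSpace ℝ (Fin q)}
  {Ω : Type*} [MeasurableSpace Ω] {μ : Measure Ω}

/-! ### The law of a draw -/

theorem mem_feasible (R : SMMRun P Fhat ε η N T θ₀ μ) (h₀ : θ₀ ∈ P.Θ) {ν : ℕ} (hν : ν ≤ T)
    (ω : Ω) : R.θ ν ω ∈ P.Θ := by
  induction ν with
  | zero => rwa [R.initial]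
  | succ ν ih =>
    rw [R.update ν hν]
    split_ifs
    exacts [(R.candidate ν hν ω).1, ih (Nat.le_of_lt hν)]

theorem measurable_iterate (R : SMMRun P Fhat ε η N T θ₀ μ) {ν : ℕ} (hν : ν ≤ T) :
    Measurable (R.θ ν) :=
  (R.measurable_θ ν hν).mono (R.𝓕.le ν) le_rfl

theorem measurableSet_draw (R : SMMRun P Fhat ε η N T θ₀ μ) {ν : ℕ} (hν : ν < T)
    (J : IndexMap n d K) (z : Fin (N ν) → Fin n) :
    MeasurableSet {ω | R.I ν ω = J ∧ R.ξ ν ω = z} :=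
  (((R.measurable_I ν hν).mono (R.𝓕.le _) le_rfl) (measurableSet_singleton J)).inter
    (((R.measurable_ξ ν hν).mono (R.𝓕.le _) le_rfl) (measurableSet_singleton z))

/-- The law `draw`, applied to the event that `J` is inactive, has integrand zero. There are
finitely many pairs `J`, `z`. -/
theorem ae_mem_activeMaps (hK : 0 < K) (R : SMMRun P Fhat ε η N T θ₀ μ) {ν : ℕ} (hν : ν < T) :
    ∀ᵐ ω ∂μ, R.I ν ω ∈ P.activeMaps ε (R.θ ν ω) := by
  have hA : ∀ J, MeasurableSet[R.𝓕 ν] {ω | J ∉ P.activeMaps ε (R.θ ν ω)} := fun J =>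
    R.measurable_θ ν hν.le
      (ERMProblem.isClosed_setOf_mem_activeMaps hK P ε J).measurableSet.compl
  have hnull : μ (⋃ J, ⋃ z, {ω | J ∉ P.activeMaps ε (R.θ ν ω)} ∩
      {ω | R.I ν ω = J ∧ R.ξ ν ω = z}) = 0 := by
    refine measure_iUnion_null fun J => measure_iUnion_null fun z => ?_
    rw [R.draw ν hν _ (hA J), setLIntegral_congr_fun (g := fun _ => 0) (R.𝓕.le ν _ (hA J))]
    · simp
    · intro ω hω
      simp only [Set.mem_ofPred_eq] at hω
      simp [hω]
  refine measure_mono_null (fun ω hω => ?_) hnull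
  simp only [Set.mem_iUnion]
  exact ⟨R.I ν ω, R.ξ ν ω, hω, rfl, rfl⟩

/-- The part of the law of `θ^ν` where `J` and `z` are drawn. -/
theorem setIntegral_draw (hn : 0 < n) (hK : 0 < K) (R : SMMRun P Fhat ε η N T θ₀ μ) {ν : ℕ}
    (hν : ν < T) (J : IndexMap n d K) (z : Fin (N ν) → Fin n)
    {ψ : EuclideanSpace ℝ (Fin q) → ℝ} (hψ : Measurable ψ) :
    ∫ ω in {ω | R.I ν ω = J ∧ R.ξ ν ω = z}, ψ (R.θ ν ω) ∂μ =
      ∫ ω, P.drawWeight ε J (R.θ ν ω) * ((n : ℝ)⁻¹) ^ N ν * ψ (R.θ ν ω) ∂μ := by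
  have hθ := R.measurable_iterate hν.le
  have hw : Measurable fun ω =>
      ENNReal.ofReal (P.drawWeight ε J (R.θ ν ω) * ((n : ℝ)⁻¹) ^ N ν) :=
    (((ERMProblem.measurable_drawWeight hK P ε J).comp hθ).mul_const _).ennreal_ofReal
  -- Taking preimages of Borel sets under `θ^ν` as events in `draw` identifies the two image
  -- measures. Only functions of `θ^ν` are integrated, so no conditional expectation is needed.
  have hlaw : (μ.restrict {ω | R.I ν ω = J ∧ R.ξ ν ω = z}).map (R.θ ν) =
      (μ.withDensity fun ω =>
        ENNReal.ofReal (P.drawWeight ε J (R.θ ν ω) * ((n : ℝ)⁻¹) ^ N ν)).map (R.θ ν) := by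
    ext B hB
    rw [Measure.map_apply hθ hB, Measure.map_apply hθ hB, Measure.restrict_apply (hθ hB),
      R.draw ν hν _ (R.measurable_θ ν hν.le hB), withDensity_apply _ (hθ hB)]
    refine lintegral_congr fun ω => ?_
    rw [ENNReal.ofReal_mul (ERMProblem.drawWeight_nonneg _ _ _), ENNReal.ofReal_pow (by positivity),
      ENNReal.ofReal_inv_of_pos (by positivity), ENNReal.ofReal_natCast]
    unfold ERMProblem.drawWeight
    split_ifs with h
    · rw [ENNReal.ofReal_inv_of_pos (by exact_mod_cast Finset.card_pos.2 ⟨J, h⟩),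
        ENNReal.ofReal_natCast]
    · simp
  rw [← integral_map (f := ψ) hθ.aemeasurable hψ.aestronglyMeasurable, hlaw,
    integral_map hθ.aemeasurable hψ.aestronglyMeasurable,
    integral_withDensity_eq_integral_toReal_smul hw (ae_of_all _ fun _ => ENNReal.ofReal_lt_top)]
  refine integral_congr_ae (ae_of_all _ fun ω => ?_)
  simp only [smul_eq_mul]
  rw [ENNReal.toReal_ofReal (mul_nonneg (ERMProblem.drawWeight_nonneg _ _ _) (by positivity))]

/-- An expectation after a draw is bounded by averaging over the draw. -/
theorem integral_le_of_draw [IsProbabilityMeasure μ] (hn : 0 < n) (hK : 0 < K)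
    (R : SMMRun P Fhat ε η N T θ₀ μ) {ν : ℕ} (hν : ν < T) {g : Ω → ℝ} (hg : Integrable g μ)
    {Ψ : IndexMap n d K → (Fin (N ν) → Fin n) → EuclideanSpace ℝ (Fin q) → ℝ}
    (hΨ : ∀ J z, Measurable (Ψ J z)) (hb : ∀ J z, ∃ C, ∀ x, ‖Ψ J z x‖ ≤ C)
    (hle : ∀ᵐ ω ∂μ, g ω ≤ Ψ (R.I ν ω) (R.ξ ν ω) (R.θ ν ω)) :
    Integrable (fun ω => ∑ J, P.drawWeight ε J (R.θ ν ω) *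
        sampleMean fun z => Ψ J z (R.θ ν ω)) μ ∧
      ∫ ω, g ω ∂μ ≤ ∫ ω, ∑ J, P.drawWeight ε J (R.θ ν ω) *
        sampleMean (fun z => Ψ J z (R.θ ν ω)) ∂μ := by
  have hθ := R.measurable_iterate hν.le
  have hi : ∀ J z, Integrable (fun ω => Ψ J z (R.θ ν ω)) μ := fun J z => by
    obtain ⟨C, hC⟩ := hb J z
    exact Integrable.of_bound ((hΨ J z).comp hθ).aestronglyMeasurable C
      (ae_of_all _ fun ω => hC _)
  have hiw : ∀ J z, Integrable (fun ω =>
      P.drawWeight ε J (R.θ ν ω) * ((n : ℝ)⁻¹) ^ N ν * Ψ J z (R.θ ν ω)) μ := fun J z => by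
    refine (hi J z).bdd_mul (c := 1 * ((n : ℝ)⁻¹) ^ N ν)
      (((ERMProblem.measurable_drawWeight hK P ε J).comp hθ).mul_const _).aestronglyMeasurable
      (ae_of_all _ fun ω => ?_)
    rw [Real.norm_of_nonneg (mul_nonneg (ERMProblem.drawWeight_nonneg _ _ _) (by positivity))]
    exact mul_le_mul_of_nonneg_right (ERMProblem.drawWeight_le_one _ _ _) (by positivity)
  have hsum : (fun ω => ∑ J, P.drawWeight ε J (R.θ ν ω) *
        sampleMean fun z => Ψ J z (R.θ ν ω)) = fun ω => ∑ y : IndexMap n d K × (Fin (N ν) → Fin n),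
        P.drawWeight ε y.1 (R.θ ν ω) * ((n : ℝ)⁻¹) ^ N ν * Ψ y.1 y.2 (R.θ ν ω) := by
    ext ω
    simp only [sampleMean, Finset.mul_sum, Fintype.sum_prod_type, mul_assoc]
  rw [hsum]
  refine ⟨integrable_finsetSum _ fun y _ => hiw y.1 y.2, ?_⟩
  have hset : ∀ y : IndexMap n d K × (Fin (N ν) → Fin n),
      {ω | (R.I ν ω, R.ξ ν ω) = y} = {ω | R.I ν ω = y.1 ∧ R.ξ ν ω = y.2} := fun y => by
    ext ω
    simp [Prod.ext_iff]
  have hm : ∀ y : IndexMap n d K × (Fin (N ν) → Fin n),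
      MeasurableSet {ω | (R.I ν ω, R.ξ ν ω) = y} := fun y => by
    rw [hset]
    exact R.measurableSet_draw hν _ _
  -- The pair of draws has finitely many values, and on each fibre the random bound is a fixed
  -- function of `θ^ν`.
  rw [integral_eq_sum_fiber hm hg, integral_finsetSum _ fun y _ => hiw y.1 y.2]
  refine Finset.sum_le_sum fun y _ => ?_
  rw [← R.setIntegral_draw hn hK hν y.1 y.2 (hΨ _ _), hset]
  refine setIntegral_mono_on_ae hg.integrableOn (hi _ _).integrableOn
    (R.measurableSet_draw hν _ _) (hle.mono fun ω hω hy => ?_)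
  rwa [hy.1, hy.2] at hω
end SMMRun

namespace SMMRun

variable {n d K q : ℕ} {P : ERMProblem n d K q} {Fhat : SurrogateFamily n d K q}
  {ε η : ℝ} {N : ℕ → ℕ} {T : ℕ} {θ₀ : EuclideanSpace ℝ (Fin q)}
  {Ω : Type*} [MeasurableSpace Ω] {μ : Measure Ω}

/-! ### Descent in expectation -/

theorem integrable_F [IsProbabilityMeasure μ] (hK : 0 < K)
    (hφ : ∀ s : Fin n, BDifferentiable (P.φ s)) (hΘ : IsCompact P.Θ)
    (R : SMMRun P Fhat ε η N T θ₀ μ) (h₀ : θ₀ ∈ P.Θ) {ν : ℕ} (hν : ν ≤ T) :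
    Integrable (fun ω => P.F (R.θ ν ω)) μ := by
  have hc := ERMProblem.continuous_F hK hφ
  obtain ⟨C, hC⟩ := hΘ.exists_bound_of_continuousOn hc.continuousOn
  exact Integrable.of_bound (hc.measurable.comp (R.measurable_iterate hν)).aestronglyMeasurable C
    (ae_of_all _ fun ω => hC _ (R.mem_feasible h₀ hν ω))

theorem integrable_meanResidual [IsProbabilityMeasure μ] (hK : 0 < K)
    (hφ : ∀ s : Fin n, BDifferentiable (P.φ s)) (hΘ : IsCompact P.Θ) (hΘc : Convex ℝ P.Θ)
    (hF : P.IsSurrogateFamily Fhat) (hε : 0 ≤ ε) {ρ : ℝ} (hρ : 0 < ρ)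
    (R : SMMRun P Fhat ε η N T θ₀ μ) {ν : ℕ} (hν : ν ≤ T) :
    Integrable (fun ω => P.meanResidual Fhat ε ρ (R.θ ν ω)) μ := by
  refine Integrable.of_bound ((ERMProblem.measurable_meanResidual hK hφ hΘ hΘc hF hε hρ).comp
    (R.measurable_iterate hν)).aestronglyMeasurable (Metric.diam P.Θ) (ae_of_all _ fun ω => ?_)
  rw [Real.norm_of_nonneg (ERMProblem.meanResidual_nonneg _ _ _)]
  exact ERMProblem.meanResidual_le_diam hK hΘ hF hε ρ _

theorem integrable_sqResidual [IsProbabilityMeasure μ] (hK : 0 < K)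
    (hφ : ∀ s : Fin n, BDifferentiable (P.φ s)) (hΘ : IsCompact P.Θ) (hΘc : Convex ℝ P.Θ)
    (hF : P.IsSurrogateFamily Fhat) (hε : 0 ≤ ε) {ρ : ℝ} (hρ : 0 < ρ)
    (R : SMMRun P Fhat ε η N T θ₀ μ) {ν : ℕ} (hν : ν ≤ T) :
    Integrable (fun ω => P.sqResidual Fhat ε ρ (R.θ ν ω)) μ := by
  refine Integrable.of_bound ((ERMProblem.measurable_sqResidual hK hφ hΘ hΘc hF hε hρ).comp
    (R.measurable_iterate hν)).aestronglyMeasurable (Metric.diam P.Θ ^ 2)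
    (ae_of_all _ fun ω => ?_)
  rw [Real.norm_of_nonneg (ERMProblem.sqResidual_nonneg _ _ _)]
  exact ERMProblem.sqResidual_le_sq_diam hK hΘ hF hε ρ _

/-- One iteration decreases the expected objective, up to the mean `e` of the stochastic errors. -/
theorem integral_F_succ_le [IsProbabilityMeasure μ] (hn : 0 < n) (hK : 0 < K)
    (hφ : ∀ s : Fin n, BDifferentiable (P.φ s)) (hΘ : IsCompact P.Θ) (hΘc : Convex ℝ P.Θ)
    (hF : P.IsSurrogateFamily Fhat) (hε : 0 ≤ ε) {ρ : ℝ} (hρ : 0 < ρ)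
    (R : SMMRun P Fhat ε η N T θ₀ μ) (h₀ : θ₀ ∈ P.Θ) {ν : ℕ} (hν : ν < T) (hN : 0 < N ν)
    {e : (Fin (N ν) → Fin n) → ℝ}
    (he : ∀ z, ∀ x ∈ P.Θ, ∀ y ∈ P.Θ,
      (P.F y - P.FN z y) - (P.F x - P.FN z x) ≤ e z + η / 2 * ‖y - x‖ ^ 2) :
    ∫ ω, P.F (R.θ (ν + 1) ω) ∂μ ≤ ∫ ω, P.F (R.θ ν ω) ∂μ
      - (ρ - η) / 2 * ∫ ω, P.sqResidual Fhat ε ρ (R.θ ν ω) ∂μ + sampleMean e := by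
  have hc := ERMProblem.continuous_F hK hφ
  have hcN := fun z : Fin (N ν) → Fin n => ERMProblem.continuous_FN hK hφ z
  -- The error `F - FN` at the new iterate is replaced by the one at the old iterate, which has mean
  -- zero, plus `e`. The extra `η / 2 * ‖y - x‖ ^ 2` is paid by the quadratic term of
  -- `sampleStep_le_stepBound`. The indicators make the bound measurable and bounded on the whole
  -- space.
  obtain ⟨hi, hle⟩ := R.integral_le_of_draw hn hK hν (R.integrable_F hK hφ hΘ h₀ hν)
    (Ψ := fun J z x => (P.activeSet ε J).indicator (P.stepBound Fhat η ρ J z) x +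
      P.Θ.indicator (fun x => P.F x - P.FN z x + e z) x)
    (fun J z => (ERMProblem.measurable_indicator_stepBound hK hφ hΘ hΘc hF hε η hρ J z).add
      ((((hc.sub (hcN z)).add continuous_const).measurable).indicator hΘ.measurableSet))
    (fun J z => by
      obtain ⟨C₁, h₁⟩ := ERMProblem.exists_bound_stepBound hK hφ hΘ hF ε η ρ J z
      obtain ⟨C₂, h₂⟩ := hΘ.exists_bound_of_continuousOn
        ((hc.sub (hcN z)).add (continuous_const (y := e z))).continuousOn
      refine ⟨C₁ + max 0 C₂, fun x => norm_add_le_of_le (h₁ x) ?_⟩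
      by_cases hx : x ∈ P.Θ
      · rw [Set.indicator_of_mem hx]
        exact (h₂ x hx).trans (le_max_right _ _)
      · rw [Set.indicator_of_notMem hx, norm_zero]
        exact le_max_left _ _)
    ((R.ae_mem_activeMaps hK hν).mono fun ω hω => by
      have hx := R.mem_feasible h₀ hν.le ω
      have hA : R.θ ν ω ∈ P.activeSet ε (R.I ν ω) := ⟨hx, hω⟩
      rw [Set.indicator_of_mem hA, Set.indicator_of_mem hx]
      have h1 := ERMProblem.sampleStep_le_stepBound (ρ := ρ) hΘ hF hε (R.ξ ν ω) hA
        (R.candidate ν hν ω).1 (R.candidate ν hν ω).2 (R.update ν hν ω)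
      have h2 := he (R.ξ ν ω) _ hx _ (R.mem_feasible h₀ hν ω)
      linarith)
  refine hle.trans ?_
  have hiF := R.integrable_F hK hφ hΘ h₀ hν.le
  have his := (R.integrable_sqResidual hK hφ hΘ hΘc hF hε hρ hν.le).const_mul ((ρ - η) / 2)
  rw [← integral_const_mul, ← integral_sub hiF his]
  have hconst : sampleMean e = ∫ _ω, sampleMean e ∂μ := by simp
  have hdiff : Integrable (fun ω => P.F (R.θ ν ω) -
      (ρ - η) / 2 * P.sqResidual Fhat ε ρ (R.θ ν ω)) μ := hiF.sub his
  rw [hconst, ← integral_add hdiff (integrable_const _)]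
  refine integral_mono hi (hdiff.add (integrable_const _)) fun ω => ?_
  have hx := R.mem_feasible h₀ hν.le ω
  generalize R.θ ν ω = x at hx
  calc _ ≤ ∑ J, P.drawWeight ε J x *
        (P.F x - (ρ - η) / 2 * P.residual Fhat ε ρ J x ^ 2 + sampleMean e) := by
        refine Finset.sum_le_sum fun J _ => ERMProblem.drawWeight_mul_le fun hJ => ?_
        have hA : x ∈ P.activeSet ε J := ⟨hx, hJ⟩
        simp only [Set.indicator_of_mem hA, Set.indicator_of_mem hx]
        rw [sampleMean_add, sampleMean_add, sampleMean_sub, sampleMean_const hn,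
          ERMProblem.sampleMean_FN hn hN, ERMProblem.residual_of_active hx hJ]
        have := ERMProblem.sampleMean_stepBound_le (P := P) (Fhat := Fhat) hn hN η ρ J x
        linarith
    _ = _ := by
        simp only [mul_add, mul_sub, Finset.sum_add_distrib, Finset.sum_sub_distrib,
          ← Finset.sum_mul, ERMProblem.sum_drawWeight hK P hε, one_mul,
          mul_left_comm _ ((ρ - η) / 2), ← Finset.mul_sum]
        rfl

/-- The one-step decreases telescope, and the last expected value is at least the infimum of `F` on
`Θ`. -/
theorem sum_sqResidual_le [IsProbabilityMeasure μ] (hn : 0 < n) (hK : 0 < K)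
    (hφ : ∀ s : Fin n, BDifferentiable (P.φ s)) (hΘ : IsCompact P.Θ) (hΘc : Convex ℝ P.Θ)
    (hF : P.IsSurrogateFamily Fhat) (hε : 0 ≤ ε) {ρ : ℝ} (hρ : 0 < ρ)
    (R : SMMRun P Fhat ε η N T θ₀ μ) (h₀ : θ₀ ∈ P.Θ) (hN : ∀ ν, 0 < N ν)
    {e : (ν : ℕ) → (Fin (N ν) → Fin n) → ℝ}
    (he : ∀ ν z, ∀ x ∈ P.Θ, ∀ y ∈ P.Θ,
      (P.F y - P.FN z y) - (P.F x - P.FN z x) ≤ e ν z + η / 2 * ‖y - x‖ ^ 2) :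
    (ρ - η) / 2 * ∑ ν ∈ Finset.range T, ∫ ω, P.sqResidual Fhat ε ρ (R.θ ν ω) ∂μ ≤
      P.F θ₀ - sInf (P.F '' P.Θ) + ∑ ν ∈ Finset.range T, sampleMean (e ν) := by
  have h : ∀ m ≤ T, (ρ - η) / 2 *
      ∑ ν ∈ Finset.range m, ∫ ω, P.sqResidual Fhat ε ρ (R.θ ν ω) ∂μ ≤
      P.F θ₀ - ∫ ω, P.F (R.θ m ω) ∂μ + ∑ ν ∈ Finset.range m, sampleMean (e ν) := by
    intro m hm
    induction m with
    | zero => simp [R.initial]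
    | succ m ih =>
      have h1 := ih (Nat.le_of_lt hm)
      have h2 := R.integral_F_succ_le hn hK hφ hΘ hΘc hF hε hρ h₀ hm (hN m) (he m)
      rw [Finset.sum_range_succ, Finset.sum_range_succ, mul_add]
      linarith
  have hmin : sInf (P.F '' P.Θ) ≤ ∫ ω, P.F (R.θ T ω) ∂μ := by
    have h1 := integral_mono (integrable_const (sInf (P.F '' P.Θ)))
      (R.integrable_F hK hφ hΘ h₀ le_rfl) fun ω =>
        csInf_le (ERMProblem.bddBelow_image_F hK hφ hΘ) ⟨_, R.mem_feasible h₀ le_rfl ω, rfl⟩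
    simpa using h1
  linarith [h T le_rfl]

/-! ### The output -/

/-- By independence, restricting to `τ = t` multiplies the law of `θ^t` by `1 / T`. -/
theorem setIntegral_output (R : SMMRun P Fhat ε η N T θ₀ μ) (t : Fin T)
    {ψ : EuclideanSpace ℝ (Fin q) → ℝ} (hψ : Measurable ψ) :
    ∫ ω in {ω | R.τ ω = t}, ψ (R.θ t ω) ∂μ = (T : ℝ)⁻¹ * ∫ ω, ψ (R.θ t ω) ∂μ := by
  have hθ := R.measurable_iterate t.2.le
  have hind : IndepFun R.τ (R.θ t) μ :=
    R.output_indep.comp (φ := id) (ψ := fun x : Fin T → EuclideanSpace ℝ (Fin q) => x t)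
      measurable_id (measurable_pi_apply t)
  have hlaw : (μ.restrict {ω | R.τ ω = t}).map (R.θ t) =
      ((T : ℝ≥0∞)⁻¹) • μ.map (R.θ t) := by
    ext B hB
    rw [Measure.map_apply hθ hB, Measure.restrict_apply (hθ hB), Measure.smul_apply,
      Measure.map_apply hθ hB, smul_eq_mul, ← R.output_uniform t, Set.inter_comm]
    exact hind.measure_inter_preimage_eq_mul {t} B (measurableSet_singleton t) hB
  rw [← integral_map (f := ψ) hθ.aemeasurable hψ.aestronglyMeasurable, hlaw,
    integral_smul_measure, integral_map hθ.aemeasurable hψ.aestronglyMeasurable]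
  simp

theorem measurable_output (R : SMMRun P Fhat ε η N T θ₀ μ) : Measurable R.output := by
  have h : Measurable fun w : Fin T × Ω => R.θ w.1 w.2 :=
    measurable_from_prod_countable_right fun t => R.measurable_iterate t.2.le
  exact h.comp (R.measurable_τ.prodMk measurable_id)

/-- A bound on the accumulated squared residuals gives the rate for the output. -/
theorem rate_of_sum_sqResidual_le [IsProbabilityMeasure μ] (hK : 0 < K)
    (hφ : ∀ s : Fin n, BDifferentiable (P.φ s)) (hΘ : IsCompact P.Θ) (hΘc : Convex ℝ P.Θ)
    (hF : P.IsSurrogateFamily Fhat) (hε : 0 ≤ ε) {ρ : ℝ} (hρ : 0 < ρ) (hηρ : η < ρ)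
    (R : SMMRun P Fhat ε η N T θ₀ μ) (h₀ : θ₀ ∈ P.Θ) (hT : 0 < T) {X : ℝ}
    (hX : (ρ - η) / 2 *
      ∑ ν ∈ Finset.range T, ∫ ω, P.sqResidual Fhat ε ρ (R.θ ν ω) ∂μ ≤ X) :
    Integrable (fun ω => P.rbar Fhat ε ρ (R.output ω)) μ ∧
      (∫ ω, P.rbar Fhat ε ρ (R.output ω) ∂μ) ^ 2 ≤ X / ((ρ - η) / 2 * T) := by
  have hT' : (0 : ℝ) < T := by exact_mod_cast hT
  have hm := ERMProblem.measurable_meanResidual hK hφ hΘ hΘc hF hε hρ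
  have hrw : (fun ω => P.rbar Fhat ε ρ (R.output ω)) =
      fun ω => P.meanResidual Fhat ε ρ (R.output ω) :=
    funext fun ω => ERMProblem.rbar_eq_meanResidual (R.mem_feasible h₀ (R.τ ω).2.le ω)
  have hint : Integrable (fun ω => P.meanResidual Fhat ε ρ (R.output ω)) μ := by
    refine Integrable.of_bound (hm.comp R.measurable_output).aestronglyMeasurable
      (Metric.diam P.Θ) (ae_of_all _ fun ω => ?_)
    rw [Real.norm_of_nonneg (ERMProblem.meanResidual_nonneg _ _ _)]
    exact ERMProblem.meanResidual_le_diam hK hΘ hF hε ρ _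
  rw [hrw]
  refine ⟨hint, ?_⟩
  have hτ : ∀ t, MeasurableSet {ω | R.τ ω = t} := fun t =>
    R.measurable_τ (measurableSet_singleton t)
  have hmean : ∫ ω, P.meanResidual Fhat ε ρ (R.output ω) ∂μ =
      ∑ t : Fin T, (T : ℝ)⁻¹ * ∫ ω, P.meanResidual Fhat ε ρ (R.θ t ω) ∂μ := by
    rw [integral_eq_sum_fiber hτ hint]
    refine Finset.sum_congr rfl fun t _ => ?_
    rw [← R.setIntegral_output t hm]
    refine setIntegral_congr_fun (hτ t) fun ω hω => ?_
    have hω' : R.τ ω = t := hω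
    simp only [output, hω']
  -- The square moves inside three averages in turn: over the output index here, then over `Ω` and
  -- over the index maps in `hsq`.
  have hjensen : (∑ t : Fin T, (T : ℝ)⁻¹ * ∫ ω, P.meanResidual Fhat ε ρ (R.θ t ω) ∂μ) ^ 2 ≤
      ∑ t : Fin T, (T : ℝ)⁻¹ * (∫ ω, P.meanResidual Fhat ε ρ (R.θ t ω) ∂μ) ^ 2 :=
    (Even.convexOn_pow (𝕜 := ℝ) even_two).map_sum_le (fun _ _ => by positivity)
      (by simp [hT'.ne']) fun _ _ => Set.mem_univ _
  have hsq : ∀ t : Fin T, (∫ ω, P.meanResidual Fhat ε ρ (R.θ t ω) ∂μ) ^ 2 ≤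
      ∫ ω, P.sqResidual Fhat ε ρ (R.θ t ω) ∂μ := fun t => by
    have his := R.integrable_sqResidual hK hφ hΘ hΘc hF hε hρ t.2.le
    have hi2 : Integrable (fun ω => P.meanResidual Fhat ε ρ (R.θ t ω) ^ 2) μ :=
      his.mono' ((hm.comp (R.measurable_iterate t.2.le)).pow_const 2).aestronglyMeasurable
        (ae_of_all _ fun ω => by
          rw [Real.norm_of_nonneg (sq_nonneg _)]
          exact ERMProblem.sq_meanResidual_le hK hε ρ _)
    exact (sq_integral_le (R.integrable_meanResidual hK hφ hΘ hΘc hF hε hρ t.2.le) hi2).trans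
      (integral_mono hi2 his fun ω => ERMProblem.sq_meanResidual_le hK hε ρ _)
  rw [hmean, le_div_iff₀ (by nlinarith)]
  rw [Finset.sum_range] at hX
  have h1 := hjensen.trans (Finset.sum_le_sum fun t _ =>
    mul_le_mul_of_nonneg_left (hsq t) (by positivity : (0 : ℝ) ≤ (T : ℝ)⁻¹))
  rw [← Finset.mul_sum (f := fun t : Fin T => ∫ ω, P.sqResidual Fhat ε ρ (R.θ t ω) ∂μ)] at h1
  refine le_trans ?_ hX
  have hpos : 0 ≤ (ρ - η) / 2 * T := by nlinarith
  refine (mul_le_mul_of_nonneg_right h1 hpos).trans_eq ?_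
  field_simp

end SMMRun

/-! ### Comparison of the error terms -/

/-- Monotonicity of the logarithm. At `m = 1` the right side vanishes, so sample size one needs
separate treatment. -/
theorem inv_sqrt_le_sqrt_log_div {m : ℕ} (hm : 2 ≤ m) :
    1 / √(m : ℝ) ≤ 1 / √(Real.log 2) * √(Real.log m / m) := by
  have hm' : (2 : ℝ) ≤ m := by exact_mod_cast hm
  have hlog : 0 < Real.log 2 := Real.log_pos (by norm_num)
  rw [Real.sqrt_div (hlog.le.trans (Real.log_le_log (by norm_num) hm')), ← mul_div_assoc]
  gcongr
  rw [one_div, ← div_eq_inv_mul, le_div_iff₀ (Real.sqrt_pos.2 hlog), one_mul]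
  exact Real.sqrt_le_sqrt (Real.log_le_log (by norm_num) hm')

/-! ### Mean stochastic error of one iteration. -/

namespace ERMProblem

variable {n d K q : ℕ} {P : ERMProblem n d K q} {Fhat : SurrogateFamily n d K q}

/-- The error of one iteration is of order `N ^ (-1/2)`. -/
theorem exists_sampleError_rate (hn : 0 < n) (hK : 0 < K)
    (hφ : ∀ s : Fin n, BDifferentiable (P.φ s)) (hΘ : IsCompact P.Θ) :
    ∃ M : ℝ, 0 < M ∧ ∃ c : ℝ, ∀ N : ℕ, 0 < N →
      (∀ z : Fin N → Fin n, ∀ x ∈ P.Θ, ∀ y ∈ P.Θ,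
        (P.F y - P.FN z y) - (P.F x - P.FN z x) ≤ totalDev z * c) ∧
      sampleMean (fun z : Fin N → Fin n => totalDev z * c) ≤ M * (1 / √N) := by
  obtain ⟨L, hL0, hL⟩ := exists_lipschitz_Fs hK hφ hΘ
  have hD : 0 ≤ Metric.diam P.Θ := Metric.diam_nonneg
  -- The summand `1` only makes the constant positive, as `L` or the diameter may be zero.
  refine ⟨n * (L * Metric.diam P.Θ) + 1, by positivity, L * Metric.diam P.Θ,
    fun N hN => ⟨fun z x hx y hy => ?_, ?_⟩⟩
  · refine (sampleError_sub_le hL hN z hx hy).trans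
      (mul_le_mul_of_nonneg_left ?_ (totalDev_nonneg z))
    rw [← dist_eq_norm]
    exact mul_le_mul_of_nonneg_left (Metric.dist_le_diam_of_mem hΘ.isBounded hy hx) hL0
  · simp only [mul_comm (totalDev _)]
    rw [sampleMean_const_mul]
    have h := mul_le_mul_of_nonneg_left (sampleMean_totalDev_le (N := N) hn hN)
      (by positivity : 0 ≤ L * Metric.diam P.Θ)
    have h2 : (0 : ℝ) ≤ 1 / √N := by positivity
    calc _ ≤ _ := h
      _ = n * (L * Metric.diam P.Θ) * (1 / √N) := by ring
      _ ≤ _ := by gcongr; linarith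

/-- With a proximal term, the error of one iteration is of order `1 / N`. -/
theorem exists_sampleError_rate_prox (hn : 0 < n) (hK : 0 < K)
    (hφ : ∀ s : Fin n, BDifferentiable (P.φ s)) (hΘ : IsCompact P.Θ) {η : ℝ} (hη : 0 < η) :
    ∃ M : ℝ, 0 < M ∧ ∃ c : ℝ, ∀ N : ℕ, 0 < N →
      (∀ z : Fin N → Fin n, ∀ x ∈ P.Θ, ∀ y ∈ P.Θ,
        (P.F y - P.FN z y) - (P.F x - P.FN z x) ≤ c * totalDev z ^ 2 + η / 2 * ‖y - x‖ ^ 2) ∧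
      sampleMean (fun z : Fin N → Fin n => c * totalDev z ^ 2) ≤ M * (1 / N) := by
  obtain ⟨L, hL0, hL⟩ := exists_lipschitz_Fs hK hφ hΘ
  refine ⟨L ^ 2 / (2 * η) * n ^ 2 + 1, by positivity, L ^ 2 / (2 * η),
    fun N hN => ⟨fun z x hx y hy => ?_, ?_⟩⟩
  · refine (sampleError_sub_le hL hN z hx hy).trans ?_
    -- Young's inequality, weighted so that the quadratic term has exactly the coefficient `η / 2`
    -- available from the proximal step.
    have h : 0 ≤ (L * totalDev z - η * ‖y - x‖) ^ 2 / (2 * η) := by positivity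
    have e : (L * totalDev z - η * ‖y - x‖) ^ 2 / (2 * η) = L ^ 2 / (2 * η) * totalDev z ^ 2
        + η / 2 * ‖y - x‖ ^ 2 - totalDev z * (L * ‖y - x‖) := by
      field_simp
      ring
    linarith
  · rw [sampleMean_const_mul]
    have h := mul_le_mul_of_nonneg_left (sampleMean_totalDev_sq_le (N := N) hn hN)
      (by positivity : 0 ≤ L ^ 2 / (2 * η))
    calc _ ≤ _ := h
      _ = L ^ 2 / (2 * η) * n ^ 2 * (1 / N) := by ring
      _ ≤ _ := by gcongr; linarith

end ERMProblem

/-! ### Assembly of the three rates. -/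

theorem proposition4 {n d K q : ℕ} (hn : 0 < n) (hK : 0 < K)
    (P : ERMProblem n d K q) (hφ : ∀ s : Fin n, BDifferentiable (P.φ s))
    (hΘ : IsCompact P.Θ) (hΘc : Convex ℝ P.Θ)
    (Fhat : SurrogateFamily n d K q) (hF : P.IsSurrogateFamily Fhat) :
    -- general rate: one constant for all sequences with `N ν ≥ 2`
    (∃ C₁ : ℝ, 0 < C₁ ∧
      ∀ (ε η : ℝ), 0 ≤ ε → 0 ≤ η →
      ∀ (N : ℕ → ℕ), (∀ ν, 2 ≤ N ν) →
      ∀ (T : ℕ), 0 < T → ∀ θ₀ ∈ P.Θ,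
      ∀ (Ω : Type u) [MeasurableSpace Ω] (μ : Measure Ω) [IsProbabilityMeasure μ]
        (R : SMMRun P Fhat ε η N T θ₀ μ) (ρ : ℝ), η < ρ →
        Integrable (fun ω => P.rbar Fhat ε ρ (R.output ω)) μ ∧
        (∫ ω, P.rbar Fhat ε ρ (R.output ω) ∂μ) ^ 2 ≤
          (P.F θ₀ - sInf (P.F '' P.Θ)
              + C₁ * ∑ ν ∈ Finset.range T, Real.sqrt (Real.log (N ν) / (N ν)))
            / ((ρ - η) / 2 * T)) ∧
    -- general rate: a strictly increasing sequence that may start with `N 0 = 1`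
    (∀ (N : ℕ → ℕ), StrictMono N → 1 ≤ N 0 →
      ∃ C₁ : ℝ, 0 < C₁ ∧
      ∀ (ε η : ℝ), 0 ≤ ε → 0 ≤ η →
      ∀ (T : ℕ), 0 < T → ∀ θ₀ ∈ P.Θ,
      ∀ (Ω : Type u) [MeasurableSpace Ω] (μ : Measure Ω) [IsProbabilityMeasure μ]
        (R : SMMRun P Fhat ε η N T θ₀ μ) (ρ : ℝ), η < ρ →
        Integrable (fun ω => P.rbar Fhat ε ρ (R.output ω)) μ ∧
        (∫ ω, P.rbar Fhat ε ρ (R.output ω) ∂μ) ^ 2 ≤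
          (P.F θ₀ - sInf (P.F '' P.Θ)
              + C₁ * ∑ ν ∈ Finset.range T, Real.sqrt (Real.log (N ν) / (N ν)))
            / ((ρ - η) / 2 * T)) ∧
    -- faster rate for `ε = 0` and `η > 0`
    (∀ (η : ℝ), 0 < η →
      ∃ C₂ : ℝ, 0 < C₂ ∧
      ∀ (N : ℕ → ℕ), (∀ ν, 1 ≤ N ν) →
      ∀ (T : ℕ), 0 < T → ∀ θ₀ ∈ P.Θ,
      ∀ (Ω : Type u) [MeasurableSpace Ω] (μ : Measure Ω) [IsProbabilityMeasure μ]
        (R : SMMRun P Fhat 0 η N T θ₀ μ) (ρ : ℝ), η < ρ →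
        Integrable (fun ω => P.rbar Fhat 0 ρ (R.output ω)) μ ∧
        (∫ ω, P.rbar Fhat 0 ρ (R.output ω) ∂μ) ^ 2 ≤
          (P.F θ₀ - sInf (P.F '' P.Θ)
              + C₂ * ∑ ν ∈ Finset.range T, 1 / (N ν : ℝ))
            / ((ρ - η) / 2 * T)) := by
  obtain ⟨M, hM, c, hc⟩ := ERMProblem.exists_sampleError_rate hn hK hφ hΘ
  have hlog : 0 < √(Real.log 2) := Real.sqrt_pos.2 (Real.log_pos (by norm_num))
  have hrate : ∀ {ε η : ℝ}, 0 ≤ ε → 0 ≤ η → ∀ {N : ℕ → ℕ}, (∀ ν, 0 < N ν) →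
      ∀ {T : ℕ}, ∀ {θ₀}, θ₀ ∈ P.Θ → ∀ {Ω : Type u} [MeasurableSpace Ω] {μ : Measure Ω}
        [IsProbabilityMeasure μ] (R : SMMRun P Fhat ε η N T θ₀ μ) {ρ : ℝ}, η < ρ →
        (ρ - η) / 2 * ∑ ν ∈ Finset.range T, ∫ ω, P.sqResidual Fhat ε ρ (R.θ ν ω) ∂μ ≤
          P.F θ₀ - sInf (P.F '' P.Θ) + ∑ ν ∈ Finset.range T, M * (1 / √(N ν : ℝ)) := by
    intro ε η hε hη N hN T θ₀ h₀ Ω _ μ _ R ρ hηρ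
    refine (R.sum_sqResidual_le hn hK hφ hΘ hΘc hF hε (hη.trans_lt hηρ) h₀ hN
      (e := fun ν z => totalDev z * c) fun ν z x hx y hy => ?_).trans ?_
    · exact ((hc _ (hN ν)).1 z x hx y hy).trans (le_add_of_nonneg_right (by positivity))
    · gcongr with ν
      exact (hc _ (hN ν)).2
  have hterm : ∀ m : ℕ, 2 ≤ m →
      M * (1 / √(m : ℝ)) ≤ M / √(Real.log 2) * √(Real.log m / m) := fun m hm => by
    rw [div_eq_mul_one_div M, mul_assoc]
    exact mul_le_mul_of_nonneg_left (inv_sqrt_le_sqrt_log_div hm) hM.le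
  refine ⟨⟨M / √(Real.log 2), by positivity, ?_⟩, ?_, ?_⟩
  · intro ε η hε hη N hN T hT θ₀ h₀ Ω _ μ _ R ρ hηρ
    refine R.rate_of_sum_sqResidual_le hK hφ hΘ hΘc hF hε (hη.trans_lt hηρ) hηρ h₀ hT
      ((hrate hε hη (fun ν => two_pos.trans_le (hN ν)) h₀ R hηρ).trans ?_)
    rw [Finset.mul_sum]
    exact add_le_add le_rfl (Finset.sum_le_sum fun ν _ => hterm _ (hN ν))
  · intro N hmono hN0
    have hN2 : ∀ ν, 2 ≤ N (ν + 1) := fun ν =>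
      Nat.succ_le_of_lt (hN0.trans_lt (hmono (Nat.succ_pos ν)))
    have hN : ∀ ν, 0 < N ν := fun ν => hN0.trans (hmono.monotone (Nat.zero_le ν))
    have ha : 0 < √(Real.log (N 1) / N 1) := Real.sqrt_pos.2
      (div_pos (Real.log_pos (by exact_mod_cast hN2 0)) (by exact_mod_cast hN 1))
    -- The first summand handles the iterations `ν ≥ 1`, where `N ν ≥ 2`. The second charges the
    -- error of iteration `0` to the term `ν = 1`, since the term `ν = 0` is zero when `N 0 = 1`;
    -- this causes the dependence on the sequence.
    refine ⟨M / √(Real.log 2) + M / √(Real.log (N 1) / N 1), by positivity, ?_⟩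
    intro ε η hε hη T hT θ₀ h₀ Ω _ μ _ R ρ hηρ
    have hρ := hη.trans_lt hηρ
    refine R.rate_of_sum_sqResidual_le hK hφ hΘ hΘc hF hε hρ hηρ h₀ hT ?_
    obtain rfl | ⟨m, rfl⟩ : T = 1 ∨ ∃ m, T = m + 2 := by
      rcases T with _ | _ | m
      · exact absurd hT (lt_irrefl 0)
      · exact .inl rfl
      · exact .inr ⟨m, rfl⟩
    -- For `T = 1` there is no term `ν = 1` to charge. The output is then `θ₀`, and the
    -- deterministic full step bounds its residual without any sampling error.
    · have h := ERMProblem.sqResidual_le_of_full_step (ρ := ρ) hK hφ hΘ hF hε h₀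
      have h0 := ERMProblem.sqResidual_nonneg (P := P) (Fhat := Fhat) ε ρ θ₀
      simp only [Finset.sum_range_one, R.initial, integral_const, probReal_univ, one_smul]
      refine le_trans ?_ (h.trans (le_add_of_nonneg_right (by positivity)))
      gcongr
      linarith
    · refine (hrate hε hη hN h₀ R hηρ).trans ?_
      refine add_le_add le_rfl ?_
      rw [add_mul, Finset.sum_range_succ']
      refine add_le_add ?_ ?_
      · refine (Finset.sum_le_sum fun ν _ => hterm _ (hN2 ν)).trans ?_
        rw [← Finset.mul_sum, Finset.sum_range_succ' _ (m + 1)]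
        gcongr
        exact le_add_of_nonneg_right (Real.sqrt_nonneg _)
      -- The error of iteration `0` is at most `M`, which is the second constant times the term `ν =
      -- 1`; that term occurs in the sum because `T ≥ 2`.
      · have h1 : 1 / √(N 0 : ℝ) ≤ 1 := by
          rw [div_le_one (Real.sqrt_pos.2 (by exact_mod_cast hN 0))]
          exact Real.one_le_sqrt.2 (by exact_mod_cast hN0)
        have h2 : √(Real.log (N 1) / N 1) ≤
            ∑ ν ∈ Finset.range (m + 2), √(Real.log (N ν) / N ν) :=
          Finset.single_le_sum (f := fun ν => √(Real.log (N ν) / N ν))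
            (fun ν _ => Real.sqrt_nonneg _) (Finset.mem_range.2 (by omega))
        calc M * (1 / √(N 0 : ℝ)) ≤ M * 1 := by gcongr
          _ = M / √(Real.log (N 1) / N 1) * √(Real.log (N 1) / N 1) := by
            rw [mul_one, div_mul_cancel₀ _ ha.ne']
          _ ≤ _ := by gcongr
  · intro η hη
    obtain ⟨M', hM', c', hc'⟩ := ERMProblem.exists_sampleError_rate_prox hn hK hφ hΘ hη
    refine ⟨M', hM', ?_⟩
    intro N hN T hT θ₀ h₀ Ω _ μ _ R ρ hηρ
    have hρ := hη.trans hηρ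
    refine R.rate_of_sum_sqResidual_le hK hφ hΘ hΘc hF le_rfl hρ hηρ h₀ hT
      ((R.sum_sqResidual_le hn hK hφ hΘ hΘc hF le_rfl hρ h₀ hN
        (e := fun ν z => c' * totalDev z ^ 2) fun ν z => (hc' _ (hN ν)).1 z).trans ?_)
    rw [Finset.mul_sum]
    gcongr with ν
    exact (hc' _ (hN ν)).2
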